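/- Let $q>3$ be a power of an odd prime, $n\geq 3$, $\varepsilon=\pm$, and let $G=\mathrm{PSL}_n^\varepsilon(q)$, i.e. $G=\mathrm{PSL}_n(q)=\mathrm{SL}_n(q)/Z(\mathrm{SL}_n(q))$ if $\varepsilon=+$ and $G=\mathrm{PSU}_n(q)=\mathrm{SU}_n(q)/Z(\mathrm{SU}_n(q))$, defined over $\mathbb{F}_{q^2}$, if $\varepsilon=-$. A long root $\mathrm{SL}_2(q)$-subgroup of $G$ is a subgroup $\langle Z(X_r),Z(X_{-r})\rangle$, where $X_r,X_{-r}$ are opposite long root subgroups of $G$ with respect to a maximally split torus; explicitly, it is a $G$-conjugate of the image in $G$ of $\langle 1+tE_{ab},\,1+tE_{ba} : t\in\mathbb{F}_q\rangle$ with $a\neq b$ if $\varepsilon=+$, and of the image of $\langle 1+tE_{aa'},\,1+tE_{a'a} : t\in\mathbb{F}_{q^2},\ t^q=-t\rangle$ with $a'=n+1-a\neq a$ if $\varepsilon=-$, where $\mathrm{SU}_n(q)$ is taken with respect to the Hermitian form $\sum_{a=1}^n x_a^q\,y_{n+1-a}$. A classical involution of $G$ is an involution contained in some long root $\mathrm{SL}_2(q)$-subgroup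 of $G$. For an involution $i\in G$ and $g\in G$ write $i^g=g^{-1}ig$, and let $\zeta_0^i(g)$ be the unique involution of the cyclic group $\langle i\,i^g\rangle$ if $i\,i^g$ has even order, and $\zeta_0^i(g)=1$ otherwise. Let $K$ be a long root $\mathrm{SL}_2(q)$-subgroup of $G$ and let $i$ be the unique involution in $K$. Then $$\frac{|\{g\in G : \zeta_0^i(g)\text{ is a classical involution}\}|}{|G|}\ \geq\ \frac{1}{750}\left(1-\frac{2}{q}\right).$$ -/

import Mathlib

open scoped Matrix

noncomputable section

section Zeta

variable {G : Type*} [Group G]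

/-- For `x` of even order, the unique involution of the cyclic group generated by `x`
(the last non-identity term of the sequence `x ^ m, x ^ (2 * m), x ^ (4 * m), …` whenever
`2 ^ k * m`, with `m` odd, is an exponent of the group). -/
def involutionOf (x : G) : G := x ^ (orderOf x / 2)

/-- The map `ζ₀ⁱ`, with `i ^ g = g⁻¹ * i * g`; it is `1` when `i * i ^ g` has odd order. -/
def zeta0 (i g : G) : G :=
  if Even (orderOf (i * (g⁻¹ * i * g))) then involutionOf (i * (g⁻¹ * i * g)) else 1

/-- The probability that a uniformly distributed element of a finite group has property `P`. -/
def uniformProb (P : G → Prop) : ℝ := (Nat.card {g : G // P g} : ℝ) / (Nat.card G : ℝ)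

end Zeta

section Linear

variable (n : ℕ) (F : Type*) [Field F]

/-- `PSL_n(F)`, the quotient of `SL_n(F)` by its centre. -/
abbrev PSL : Type _ := Matrix.ProjectiveSpecialLinearGroup (Fin n) F

variable {n F}

/-- The root subgroup `{1 + t E_{ab} : t ∈ F}` of `SL_n(F)`; in type `A` all roots are long. -/
def slRootSet {a b : Fin n} (hab : a ≠ b) : Set (Matrix.SpecialLinearGroup (Fin n) F) :=
  {u | ∃ t : F, u = Matrix.SpecialLinearGroup.transvection hab t}

/-- Long root `SL₂(q)`-subgroups of `PSL_n(F)`: the conjugates of the images of the subgroups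
generated by two opposite root subgroups with respect to the diagonal torus. -/
def PSL.IsLongRootSL2 (K : Subgroup (PSL n F)) : Prop :=
  ∃ (a b : Fin n) (hab : a ≠ b) (g : PSL n F),
    K = ((Subgroup.closure (slRootSet (F := F) hab ∪ slRootSet hab.symm)).map
      (QuotientGroup.mk' (Subgroup.center (Matrix.SpecialLinearGroup (Fin n) F)))).map
        (MulAut.conj g).toMonoidHom

/-- A classical involution is an involution lying in a long root `SL₂(q)`-subgroup. -/
def PSL.IsClassicalInvolution (z : PSL n F) : Prop :=
  orderOf z = 2 ∧ ∃ K : Subgroup (PSL n F), PSL.IsLongRootSL2 K ∧ z ∈ K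

end Linear

section Unitary

variable (n : ℕ) (F E : Type*) [Field F] [Fintype F] [Field E] [Algebra F E]

/-- The Gram matrix (ones on the antidiagonal) of the Hermitian form
`∑ a, x_a ^ q * y_{n - 1 - a}`. -/
def hermGram : Matrix (Fin n) (Fin n) E := Matrix.of fun a b => if b = a.rev then 1 else 0

/-- `SU_n(q)`, where `q = |F|` and `E` is the quadratic extension of `F`: the elements of `SL_n(E)`
that preserve the Hermitian form above. The map `x ↦ x ^ q` of `E` is
`FiniteField.frobeniusAlgHom F E`. -/
def SU : Subgroup (Matrix.SpecialLinearGroup (Fin n) E) where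
  carrier := {A | ((A : Matrix (Fin n) (Fin n) E).map (FiniteField.frobeniusAlgHom F E))ᵀ *
    hermGram n E * (A : Matrix (Fin n) (Fin n) E) = hermGram n E}
  one_mem' := by
    simp [Matrix.map_one]
  mul_mem' := by
    intro A B hA hB
    simp only [Set.mem_ofPred_eq, Matrix.SpecialLinearGroup.coe_mul, Matrix.map_mul,
      Matrix.transpose_mul] at hA hB ⊢
    calc _ = ((B : Matrix (Fin n) (Fin n) E).map (FiniteField.frobeniusAlgHom F E))ᵀ *
          (((A : Matrix (Fin n) (Fin n) E).map (FiniteField.frobeniusAlgHom F E))ᵀ *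
            hermGram n E * (A : Matrix (Fin n) (Fin n) E)) * (B : Matrix (Fin n) (Fin n) E) := by
          simp only [Matrix.mul_assoc]
      _ = _ := by rw [hA, hB]
  inv_mem' := by
    intro A hA
    simp only [Set.mem_ofPred_eq] at hA ⊢
    have h1 : (A : Matrix (Fin n) (Fin n) E) * ((A⁻¹ : Matrix.SpecialLinearGroup (Fin n) E) :
        Matrix (Fin n) (Fin n) E) = 1 := by
      rw [← Matrix.SpecialLinearGroup.coe_mul, mul_inv_cancel, Matrix.SpecialLinearGroup.coe_one]
    have h2 : (((A⁻¹ : Matrix.SpecialLinearGroup (Fin n) E) : Matrix (Fin n) (Fin n) E).map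
        (FiniteField.frobeniusAlgHom F E))ᵀ *
        ((A : Matrix (Fin n) (Fin n) E).map (FiniteField.frobeniusAlgHom F E))ᵀ = 1 := by
      rw [← Matrix.transpose_mul, ← Matrix.map_mul, h1]
      simp [Matrix.map_one]
    conv_lhs => rw [← hA]
    rw [Matrix.mul_assoc, Matrix.mul_assoc, Matrix.mul_assoc, h1, Matrix.mul_one,
      ← Matrix.mul_assoc, h2, Matrix.one_mul]

/-- `PSU_n(q)`, the quotient of `SU_n(q)` by its centre. -/
abbrev PSU : Type _ := SU n F E ⧸ Subgroup.center (SU n F E)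

variable {n}

/-- The centre of the long root subgroup of `SU_n(q)` at the antidiagonal position `(a, n - 1 - a)`:
it consists of the `1 + t E_{a, n - 1 - a}` that lie in `SU_n(q)`, i.e. with `t ^ q = -t`. -/
def suLongRootSet {a b : Fin n} (hab : a ≠ b) : Set (SU n F E) :=
  {u | ∃ t : E, (u : Matrix.SpecialLinearGroup (Fin n) E) = Matrix.SpecialLinearGroup.transvection hab t}

variable {F E}

/-- Long root `SL₂(q)`-subgroups of `PSU_n(q)`: the conjugates of the images of the subgroups
generated by the centres of two opposite long root subgroups with respect to the diagonal torus. -/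
def PSU.IsLongRootSL2 (K : Subgroup (PSU n F E)) : Prop :=
  ∃ (a : Fin n) (ha : a ≠ a.rev) (g : PSU n F E),
    K = ((Subgroup.closure (suLongRootSet F E ha ∪ suLongRootSet F E ha.symm)).map
      (QuotientGroup.mk' (Subgroup.center (SU n F E)))).map (MulAut.conj g).toMonoidHom

/-- A classical involution is an involution lying in a long root `SL₂(q)`-subgroup. -/
def PSU.IsClassicalInvolution (z : PSU n F E) : Prop :=
  orderOf z = 2 ∧ ∃ K : Subgroup (PSU n F E), PSU.IsLongRootSL2 K ∧ z ∈ K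

end Unitary

end

set_option linter.unusedSectionVars false

/-! The linear and unitary cases are one. If `A` is the quadratic extension of `F` with its
Frobenius, then `SU_n(q)` is the special unitary group over `A` of the standard form. If `A` is `F ×
F` with the swap of factors, a unitary matrix is a pair consisting of an invertible matrix and its
inverse, so the same special unitary group is `SL_n(q)`. `QuadraticStar` records the properties of
`A` that both cases share, and the argument runs over such an `A`.

A classical involution is the image of a plane involution, which is -1 on a nondegenerate plane and
1 on its orthogonal complement (`QuadraticStar.exists_planeInvolution`,
`QuadraticStar.exists_mem_conj`). Hence it suffices that some power of `i * i ^ g` be a plane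
involution in the special unitary group: its image is not trivial when n is at least 3, so it is the
value of `zeta0` (`zeta0_eq_of_pow`).

Let P be the plane of `i` and W its translate. By transitivity on isometries a uniform g gives a
uniform W (`QuadraticStar.card_specialUnitary_mul`), so good W are to be counted. A W with a
singular value decomposition relative to P splits the problem into two orthogonal planes. In each,
the product of involutions is a product of two reflections, a rotation M of determinant 1 and trace
4c - 2, where c is the squared cosine of the angle. If c is a square and 1 - c is not, M has odd
order dividing the odd one among (q - 1)/2 and (q + 1)/2. If c is a nonsquare and 1 - c a square,
that same power of M is -1 (`pow_oddHalf_eq_one`, `pow_oddHalf_eq_neg_one`). With one parameter of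
each kind, the power is -1 on one plane and 1 on the other.

At least (q - 3)/4 values c are of each kind, and `card_good_planes` bounds from below the number of
W so obtained. Against the total number of isometries the proportion tends to 1/16, which leaves
ample room for 1/750. For n = 3 two orthogonal planes do not fit; the complementary lines are used
instead (`card_good_lines`), with a single parameter and a limiting proportion of 1/4. -/

/-- A finite commutative star ring `A` over the finite field `F` in which Hermitian forms behave
as over a quadratic extension: the fixed ring of the star is `F`, the norm `a ↦ star a * a` maps
onto `F`, the trace form is nondegenerate, and the number of unit vectors of `A ^ m` is close
to `q ^ (2 * m - 1)`. -/
structure QuadraticStar (F A : Type*) [Field F] [Fintype F] [CommRing A] [StarRing A]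
    [Algebra F A] : Prop where
  star_algebraMap : ∀ c : F, star (algebraMap F A c) = algebraMap F A c
  exists_of_star_eq : ∀ a : A, star a = a → ∃ c : F, algebraMap F A c = a
  exists_norm_eq : ∀ c : F, c ≠ 0 → ∃ d : A, star d * d = algebraMap F A c
  eq_zero_of_trace : ∀ a : A, (∀ l : A, l * a + star (l * a) = 0) → a = 0
  card_unit_lower : ∀ m : ℕ, Fintype.card F ^ (2 * m) * (Fintype.card F - 1) ≤
    Nat.card {v : Matrix (Fin (m + 1)) (Fin 1) A // vᴴ * v = 1}
  card_unit_upper : ∀ m : ℕ, Nat.card {v : Matrix (Fin (m + 1)) (Fin 1) A // vᴴ * v = 1} ≤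
    Fintype.card F ^ (2 * m) * (Fintype.card F + 1)

/-! ### Matrices supported on a nondegenerate subspace -/

section Inflate

variable {A r k l : Type*} [CommRing A] [StarRing A] [Fintype r] [DecidableEq r] [Fintype k]
  [DecidableEq k] [Fintype l] [DecidableEq l]

/-- The matrix that acts as `b` on the image of the isometry `P` and trivially on its
orthogonal complement. -/
def inflate (P : Matrix r k A) (b : Matrix k k A) : Matrix r r A := 1 + P * (b - 1) * Pᴴ

theorem inflate_one (P : Matrix r k A) : inflate P 1 = 1 := by simp [inflate]

theorem inflate_mul {P : Matrix r k A} (hP : Pᴴ * P = 1) (b c : Matrix k k A) :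
    inflate P b * inflate P c = inflate P (b * c) := by
  have h : P * (b - 1) * Pᴴ * (P * (c - 1) * Pᴴ) = P * ((b - 1) * (c - 1)) * Pᴴ := by
    calc _ = P * (b - 1) * (Pᴴ * P) * (c - 1) * Pᴴ := by simp only [Matrix.mul_assoc]
      _ = _ := by rw [hP]; simp only [Matrix.mul_assoc, Matrix.mul_one]
  have h2 : b * c - 1 = (b - 1) * (c - 1) + (b - 1) + (c - 1) := by noncomm_ring
  simp only [inflate]
  rw [add_mul, mul_add, mul_add, h, h2]
  simp only [Matrix.mul_add, Matrix.add_mul, one_mul, mul_one]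
  abel

theorem inflate_pow {P : Matrix r k A} (hP : Pᴴ * P = 1) (b : Matrix k k A) (m : ℕ) :
    inflate P b ^ m = inflate P (b ^ m) := by
  induction m with
  | zero => simp [inflate_one]
  | succ m ih => rw [pow_succ, ih, inflate_mul hP, pow_succ]

theorem conjTranspose_inflate (P : Matrix r k A) (b : Matrix k k A) :
    (inflate P b)ᴴ = inflate P bᴴ := by
  simp [inflate, Matrix.conjTranspose_mul, Matrix.mul_assoc]

theorem det_inflate {P : Matrix r k A} (hP : Pᴴ * P = 1) (b : Matrix k k A) :
    (inflate P b).det = b.det := by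
  rw [inflate, Matrix.mul_assoc, Matrix.det_one_add_mul_comm, Matrix.mul_assoc, hP,
    Matrix.mul_one, add_sub_cancel]

theorem inflate_mul_self {P : Matrix r k A} (hP : Pᴴ * P = 1) (b : Matrix k k A) :
    inflate P b * P = P * b := by
  rw [inflate, Matrix.add_mul, Matrix.one_mul, Matrix.mul_assoc, hP, Matrix.mul_one,
    Matrix.mul_sub, Matrix.mul_one, add_sub_cancel]

theorem inflate_mul_of_orthogonal {P : Matrix r k A} {Q : Matrix r l A} (h : Pᴴ * Q = 0)
    (b : Matrix k k A) : inflate P b * Q = Q := by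
  rw [inflate, Matrix.add_mul, Matrix.one_mul, Matrix.mul_assoc, h, Matrix.mul_zero, add_zero]

theorem inflate_comm {P : Matrix r k A} {Q : Matrix r l A} (h : Pᴴ * Q = 0)
    (b : Matrix k k A) (c : Matrix l l A) : Commute (inflate P b) (inflate Q c) := by
  have h' : Qᴴ * P = 0 := by
    have := congrArg Matrix.conjTranspose h
    simpa using this
  have h1 : P * (b - 1) * Pᴴ * (Q * (c - 1) * Qᴴ) = 0 := by
    calc _ = P * (b - 1) * (Pᴴ * Q) * (c - 1) * Qᴴ := by simp only [Matrix.mul_assoc]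
      _ = _ := by simp [h]
  have h2 : Q * (c - 1) * Qᴴ * (P * (b - 1) * Pᴴ) = 0 := by
    calc _ = Q * (c - 1) * (Qᴴ * P) * (b - 1) * Pᴴ := by simp only [Matrix.mul_assoc]
      _ = _ := by simp [h']
  unfold inflate Commute SemiconjBy
  rw [add_mul, mul_add, mul_add, add_mul, mul_add, mul_add, h1, h2]
  simp only [one_mul, mul_one]
  abel

theorem inflate_mul_left (B : Matrix r k A) (a : Matrix k l A) (c : Matrix l l A) :
    inflate (B * a) c = inflate B (inflate a c) := by
  simp [inflate, Matrix.conjTranspose_mul, Matrix.mul_assoc]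

theorem conj_inflate {g : Matrix r r A} (hg : g * gᴴ = 1) (P : Matrix r k A)
    (b : Matrix k k A) : g * inflate P b * gᴴ = inflate (g * P) b := by
  simp only [inflate, Matrix.mul_add, Matrix.add_mul, Matrix.mul_one, hg,
    Matrix.conjTranspose_mul, Matrix.mul_assoc]

theorem inflate_neg_one (P : Matrix r k A) : inflate P (-1) = 1 - (2 : A) • (P * Pᴴ) := by
  have h : (-1 - 1 : Matrix k k A) = -((2 : A) • 1) := by
    rw [two_smul]; abel
  rw [inflate, h, Matrix.mul_neg, Matrix.mul_smul, Matrix.mul_one, Matrix.neg_mul,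
    Matrix.smul_mul, sub_eq_add_neg]

theorem inflate_mem_unitary {P : Matrix r k A} (hP : Pᴴ * P = 1) {b : Matrix k k A}
    (hb : b ∈ Matrix.unitaryGroup k A) : inflate P b ∈ Matrix.unitaryGroup r A := by
  rw [Matrix.mem_unitaryGroup_iff, Matrix.star_eq_conjTranspose] at *
  rw [conjTranspose_inflate, inflate_mul hP, hb, inflate_one]

theorem inflate_mem_specialUnitary {P : Matrix r k A} (hP : Pᴴ * P = 1) {b : Matrix k k A}
    (hb : b ∈ Matrix.specialUnitaryGroup k A) :
    inflate P b ∈ Matrix.specialUnitaryGroup r A := by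
  rw [Matrix.mem_specialUnitaryGroup_iff] at *
  exact ⟨inflate_mem_unitary hP hb.1, by rw [det_inflate hP, hb.2]⟩

theorem neg_one_mem_specialUnitary_two :
    (-1 : Matrix (Fin 2) (Fin 2) A) ∈ Matrix.specialUnitaryGroup (Fin 2) A := by
  rw [Matrix.mem_specialUnitaryGroup_iff, Matrix.mem_unitaryGroup_iff]
  simp [Matrix.det_neg]

end Inflate

/-! ### Witt's theorem for isometries over `A` -/

section Transitivity

variable {F A : Type*} [Field F] [Fintype F] [CommRing A] [StarRing A] [Algebra F A]
  {r k : Type*} [Fintype r] [DecidableEq r] [Fintype k] [DecidableEq k]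

/-- Otherwise `W` would map the free module of smaller rank onto that of larger rank, which is
impossible over a nontrivial commutative ring. -/
theorem mul_conjTranspose_ne_one [Nontrivial A] (W : Matrix r k A)
    (hc : Fintype.card k < Fintype.card r) : W * Wᴴ ≠ 1 := by
  intro h
  have hs : Function.Surjective W.mulVecLin := by
    intro y
    exact ⟨Wᴴ *ᵥ y, by simp [Matrix.mulVec_mulVec, h]⟩
  exact absurd (card_le_of_surjective A W.mulVecLin hs) (by omega)

theorem QuadraticStar.two_ne_zero (hq : Odd (Fintype.card F)) : (2 : F) ≠ 0 := by
  have : ringChar F ≠ 2 := by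
    intro h
    exact (Nat.not_even_iff_odd.2 hq) (Nat.even_iff.2 (FiniteField.even_card_of_char_two h))
  exact Ring.two_ne_zero this

/-- Polarisation: basis vectors kill the diagonal entries, and e_a + l e_b then gives trace zero for
l times the (a, b) entry. As l is arbitrary, nondegeneracy of the trace form applies. -/
theorem QuadraticStar.eq_zero_of_form_eq_zero (hA : QuadraticStar F A) {Q : Matrix r r A}
    (hQ : Qᴴ = Q) (h : ∀ x : r → A, star x ⬝ᵥ (Q *ᵥ x) = 0) : Q = 0 := by
  have hd : ∀ a, Q a a = 0 := by
    intro a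
    have := h (Pi.single a 1)
    simpa using this
  ext a b
  apply hA.eq_zero_of_trace
  intro l
  have h1 := h (Pi.single a 1 + Pi.single b l)
  have hs : Q b a = star (Q a b) := by rw [← Matrix.conjTranspose_apply, hQ]
  simp [Matrix.mulVec_add, dotProduct_add, add_dotProduct, hd, Pi.star_single] at h1
  rw [hs] at h1
  rw [star_mul, mul_comm l, mul_comm (star (Q a b))]
  simpa [mul_comm, add_comm] using h1

/-- An isometry from a space of smaller rank leaves room for an orthogonal unit vector. -/
theorem QuadraticStar.exists_unit_orthogonal [Nontrivial A] (hA : QuadraticStar F A)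
    {W : Matrix r k A} (hW : Wᴴ * W = 1) (hc : Fintype.card k < Fintype.card r) :
    ∃ y : Matrix r (Fin 1) A, yᴴ * y = 1 ∧ Wᴴ * y = 0 := by
  -- `Q` is the orthogonal projection onto the complement of the image of `W`; a vector Qx of
  -- nonzero length is sought.
  set Q : Matrix r r A := 1 - W * Wᴴ with hQdef
  have hQH : Qᴴ = Q := by simp [hQdef]
  have hWQ : Wᴴ * Q = 0 := by
    rw [hQdef, Matrix.mul_sub, Matrix.mul_one, ← Matrix.mul_assoc, hW, Matrix.one_mul, sub_self]
  have hQQ : Q * Q = Q := by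
    conv_lhs => rw [hQdef, Matrix.sub_mul, Matrix.one_mul, Matrix.mul_assoc]
    rw [hWQ, Matrix.mul_zero, sub_zero]
  have hQ0 : Q ≠ 0 := fun h => mul_conjTranspose_ne_one W hc (sub_eq_zero.1 h).symm
  obtain ⟨x, hx⟩ : ∃ x : r → A, star x ⬝ᵥ (Q *ᵥ x) ≠ 0 := by
    by_contra! hcon
    exact hQ0 (hA.eq_zero_of_form_eq_zero hQH hcon)
  have hfix : star (star x ⬝ᵥ (Q *ᵥ x)) = star x ⬝ᵥ (Q *ᵥ x) := by
    rw [← Matrix.star_dotProduct, Matrix.star_mulVec, hQH, Matrix.dotProduct_mulVec]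
  -- `A` may have zero divisors, but a star-fixed value lies in `F`. So this nonzero length is
  -- invertible, and its inverse is a norm by which the vector can be rescaled to length 1.
  obtain ⟨c, hcx⟩ := hA.exists_of_star_eq _ hfix
  have hc0 : c ≠ 0 := by rintro rfl; exact hx (by rw [← hcx, map_zero])
  obtain ⟨e, he⟩ := hA.exists_norm_eq c⁻¹ (inv_ne_zero hc0)
  refine ⟨Matrix.replicateCol (Fin 1) (e • (Q *ᵥ x)), ?_, ?_⟩
  · ext i j
    have h1 : (star (Q *ᵥ x)) ⬝ᵥ (Q *ᵥ x) = algebraMap F A c := by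
      rw [Matrix.star_mulVec, hQH, ← Matrix.dotProduct_mulVec, Matrix.mulVec_mulVec, hQQ, hcx]
    have h2 : ((Matrix.replicateCol (Fin 1) (e • (Q *ᵥ x)))ᴴ *
        Matrix.replicateCol (Fin 1) (e • (Q *ᵥ x))) i j
        = star (e • (Q *ᵥ x)) ⬝ᵥ (e • (Q *ᵥ x)) := by
      simp [Matrix.mul_apply, dotProduct]
    rw [h2, star_smul, smul_dotProduct, dotProduct_smul, h1, smul_eq_mul, smul_eq_mul,
      ← mul_assoc, he, ← map_mul, inv_mul_cancel₀ hc0, map_one, Subsingleton.elim i j,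
      Matrix.one_apply_eq]
  · ext i j
    have h1 : Wᴴ *ᵥ (Q *ᵥ x) = 0 := by rw [Matrix.mulVec_mulVec, hWQ, Matrix.zero_mulVec]
    have h2 : (Wᴴ * Matrix.replicateCol (Fin 1) (e • (Q *ᵥ x))) i j
        = (Wᴴ *ᵥ (e • (Q *ᵥ x))) i := by
      simp [Matrix.mul_apply, Matrix.mulVec, dotProduct]
    rw [h2, Matrix.mulVec_smul, h1]
    simp

theorem QuadraticStar.exists_complement [Nontrivial A] (hA : QuadraticStar F A)
    {W : Matrix r k A} (hW : Wᴴ * W = 1) (d : ℕ) (hc : Fintype.card k + d ≤ Fintype.card r) :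
    ∃ Y : Matrix r (Fin d) A, Yᴴ * Y = 1 ∧ Wᴴ * Y = 0 := by
  induction d with
  | zero => exact ⟨0, Subsingleton.elim _ _, by simp⟩
  | succ d ih =>
    obtain ⟨Y, hY, hWY⟩ := ih (by omega)
    have hYW : Yᴴ * W = 0 := by
      have := congrArg Matrix.conjTranspose hWY
      simpa using this
    obtain ⟨y, hy, hVy⟩ := hA.exists_unit_orthogonal (W := Matrix.fromCols W Y)
      (by
        rw [Matrix.conjTranspose_fromCols_eq_fromRows_conjTranspose, Matrix.fromRows_mul_fromCols,
          hW, hY, hWY, hYW, Matrix.fromBlocks_one])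
      (by simp; omega)
    rw [Matrix.conjTranspose_fromCols_eq_fromRows_conjTranspose, Matrix.fromRows_mul,
      ← Matrix.fromRows_zero, Matrix.fromRows_ext_iff] at hVy
    obtain ⟨hWy, hYy⟩ := hVy
    have hyY : yᴴ * Y = 0 := by
      have := congrArg Matrix.conjTranspose hYy
      simpa using this
    refine ⟨Matrix.of fun i => Fin.cons (y i 0) (Y i), ?_, ?_⟩
    · ext i j
      refine Fin.cases ?_ (fun i => ?_) i <;> refine Fin.cases ?_ (fun j => ?_) j
      · simpa [Matrix.mul_apply] using congrFun₂ hy 0 0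
      · simpa [Matrix.mul_apply, Matrix.one_apply, (Fin.succ_ne_zero j).symm] using
          congrFun₂ hyY 0 j
      · simpa [Matrix.mul_apply, Matrix.one_apply] using congrFun₂ hYy i 0
      · simpa [Matrix.mul_apply, Matrix.one_apply] using congrFun₂ hY i j
    · ext i j
      refine Fin.cases ?_ (fun j => ?_) j
      · simpa [Matrix.mul_apply] using congrFun₂ hWy i 0
      · simpa [Matrix.mul_apply] using congrFun₂ hWY i j

/-- Both isometries are completed to orthonormal bases, and g carries one basis to the other. -/
theorem QuadraticStar.exists_unitary_mul_eq [Nontrivial A] (hA : QuadraticStar F A)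
    {P W : Matrix r k A} (hP : Pᴴ * P = 1) (hW : Wᴴ * W = 1)
    (hc : Fintype.card k ≤ Fintype.card r) :
    ∃ g ∈ Matrix.unitaryGroup r A, g * P = W := by
  obtain ⟨d, hd⟩ := Nat.exists_eq_add_of_le hc
  have key : ∀ V : Matrix r k A, Vᴴ * V = 1 → ∃ Y : Matrix r (Fin d) A, Yᴴ * Y = 1 ∧
      Vᴴ * Y = 0 ∧ Yᴴ * V = 0 ∧ V * Vᴴ + Y * Yᴴ = 1 := by
    intro V hV
    obtain ⟨Y, hY, hVY⟩ := hA.exists_complement hV d hd.ge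
    have hYV : Yᴴ * V = 0 := by
      have := congrArg Matrix.conjTranspose hVY
      simpa using this
    refine ⟨Y, hY, hVY, hYV, ?_⟩
    have h1 : (Matrix.fromCols V Y)ᴴ * Matrix.fromCols V Y = 1 := by
      rw [Matrix.conjTranspose_fromCols_eq_fromRows_conjTranspose, Matrix.fromRows_mul_fromCols,
        hV, hY, hVY, hYV, Matrix.fromBlocks_one]
    have h2 := (Matrix.mul_eq_one_comm_of_card_eq _ _ _ (by simp [hd])).1 h1
    rwa [Matrix.conjTranspose_fromCols_eq_fromRows_conjTranspose,
      Matrix.fromCols_mul_fromRows] at h2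
  obtain ⟨Y, hY, hPY, hYP, hPsum⟩ := key P hP
  obtain ⟨Z, hZ, hWZ, hZW, hWsum⟩ := key W hW
  refine ⟨W * Pᴴ + Z * Yᴴ, ?_, ?_⟩
  · rw [Matrix.mem_unitaryGroup_iff, Matrix.star_eq_conjTranspose]
    calc _ = W * (Pᴴ * P) * Wᴴ + W * (Pᴴ * Y) * Zᴴ + Z * (Yᴴ * P) * Wᴴ +
          Z * (Yᴴ * Y) * Zᴴ := by
          simp only [Matrix.conjTranspose_add, Matrix.conjTranspose_mul,
            Matrix.conjTranspose_conjTranspose, Matrix.mul_add, Matrix.add_mul, Matrix.mul_assoc]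
          abel
      _ = 1 := by simp [hP, hY, hPY, hYP, hWsum]
  · rw [Matrix.add_mul, Matrix.mul_assoc, hP, Matrix.mul_assoc, hYP]
    simp

/-- The special unitary group is transitive on isometries from a space of smaller rank. -/
theorem QuadraticStar.exists_specialUnitary_mul_eq [Nontrivial A] (hA : QuadraticStar F A)
    {P W : Matrix r k A} (hP : Pᴴ * P = 1) (hW : Wᴴ * W = 1)
    (hc : Fintype.card k < Fintype.card r) :
    ∃ g ∈ Matrix.specialUnitaryGroup r A, g * P = W := by
  obtain ⟨g, hg, hgP⟩ := hA.exists_unitary_mul_eq hP hW hc.le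
  obtain ⟨y, hy, hWy⟩ := hA.exists_unit_orthogonal hW hc
  have hyW : yᴴ * W = 0 := by
    have := congrArg Matrix.conjTranspose hWy
    simpa using this
  have hdet := Matrix.det_of_mem_unitary hg
  have hb : Matrix.of (fun _ _ : Fin 1 => star g.det) ∈ Matrix.unitaryGroup (Fin 1) A := by
    rw [Matrix.mem_unitaryGroup_iff]
    ext i j
    rw [Subsingleton.elim i j]
    simp [Matrix.mul_apply, Matrix.star_apply, hdet.1]
  -- The determinant is corrected on a line orthogonal to the image of `W`, so the equation g P = W
  -- survives.
  refine ⟨inflate y (Matrix.of fun _ _ => star g.det) * g, ?_, ?_⟩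
  · rw [Matrix.mem_specialUnitaryGroup_iff]
    refine ⟨mul_mem (inflate_mem_unitary hy hb) hg, ?_⟩
    rw [Matrix.det_mul, det_inflate hy]
    simp [hdet.1]
  · rw [Matrix.mul_assoc, hgP, inflate_mul_of_orthogonal hyW]

end Transitivity

/-! ### Orders of rotations and counts of square classes -/

section TorusExponent

/-- The odd one of the numbers `(q - 1) / 2` and `(q + 1) / 2`, for odd `q`. -/
def oddHalf (q : ℕ) : ℕ := if Even (q / 2) then q / 2 + 1 else q / 2

theorem odd_oddHalf (q : ℕ) : Odd (oddHalf q) := by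
  unfold oddHalf
  split_ifs with h
  · exact h.add_one
  · exact Nat.not_even_iff_odd.1 h

variable {F : Type*} [Field F] [Fintype F]

theorem ringChar_ne_two_of_odd_card (hq : Odd (Fintype.card F)) : ringChar F ≠ 2 := fun h =>
  (Nat.not_even_iff_odd.2 hq) (Nat.even_iff.2 (FiniteField.even_card_of_char_two h))

/-- With c = s², R = (M + 1)/(2s) is a square root of M satisfying R² = 2sR - 1, so its inverse is
2s - R. Put D = R - s and k = (q - 1)/2. Then D² = c - 1, and D^q = (c - 1)^k D = ±D because the
scalar is in `F`. Since Frobenius is additive on commuting elements and fixes s, R^q is s ± D, that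
is, R or its inverse. Accordingly R^(q - 1) or R^(q + 1) is 1. As 1 - c is a nonsquare, the sign is
-(-1)^k, which selects the one whose half is odd. No eigenvalues are needed. -/
theorem pow_oddHalf_eq_one (hq : Odd (Fintype.card F)) {B : Type*} [Ring B] [Nontrivial B]
    [Algebra F B] {c : F} (hc : IsSquare c) (hc' : ¬ IsSquare (1 - c)) {M : B}
    (hM : M * M = (4 * c - 2) • M - 1) : M ^ oddHalf (Fintype.card F) = 1 := by
  obtain ⟨s, rfl⟩ := hc
  have h2 : (2 : F) ≠ 0 := QuadraticStar.two_ne_zero hq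
  have hs : s ≠ 0 := by
    rintro rfl
    exact hc' (by simp)
  have hs1 : 1 - s * s ≠ 0 := fun h => hc' (h ▸ IsSquare.zero)
  set R : B := (2 * s)⁻¹ • (M + 1) with hR
  have hRR : R * R = M := by
    have : (M + 1) * (M + 1) = (4 * (s * s)) • M := by
      rw [add_mul, mul_add, hM, one_mul, mul_one, sub_smul, two_smul]
      abel
    rw [hR, smul_mul_smul_comm, this, smul_smul]
    have : (2 * s)⁻¹ * (2 * s)⁻¹ * (4 * (s * s)) = 1 := by
      field_simp
      norm_num
    rw [this, one_smul]
  have hR1 : R * R = (2 * s) • R - 1 := by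
    rw [hRR, hR, smul_smul, mul_inv_cancel₀ (mul_ne_zero h2 hs), one_smul, add_sub_cancel_right]
  have hRinv : R * ((2 * s) • 1 - R) = 1 := by
    rw [mul_sub, hR1, mul_smul_comm, mul_one, sub_sub_cancel]
  set D : B := R - algebraMap F B s with hD
  have hDD : D * D = algebraMap F B (s * s - 1) := by
    have hcomm : algebraMap F B s * R = s • R := (Algebra.smul_def s R).symm
    have hcomm' : R * algebraMap F B s = s • R := by
      rw [← Algebra.commutes, hcomm]
    rw [hD, sub_mul, mul_sub, mul_sub, hR1, hcomm, hcomm', map_sub, map_mul, map_one, two_mul,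
      add_smul]
    abel
  obtain ⟨k, hk⟩ := hq
  have hk2 : Fintype.card F / 2 = k := by omega
  have hchar : ringChar F ≠ 2 := ringChar_ne_two_of_odd_card ⟨k, hk⟩
  have hd : (s * s - 1) ^ k = -(-1) ^ k := by
    have h1 : (1 - s * s) ^ k = -1 := by
      have h := FiniteField.pow_dichotomy hchar hs1
      rw [hk2] at h
      refine h.resolve_left fun h' => hc' ((FiniteField.isSquare_iff hchar hs1).2 ?_)
      rwa [hk2]
    rw [show s * s - 1 = (-1) * (1 - s * s) by ring, mul_pow, h1]
    ring
  have hDq : D ^ Fintype.card F = algebraMap F B (-(-1) ^ k) * D := by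
    rw [hk, pow_succ, pow_mul, pow_two, hDD, ← map_pow, hd]
  have hfrob : D ^ Fintype.card F = R ^ Fintype.card F - algebraMap F B s := by
    obtain ⟨n, hp, hn⟩ := FiniteField.card F (ringChar F)
    have : Fact (ringChar F).Prime := ⟨hp⟩
    have : CharP B (ringChar F) :=
      charP_of_injective_algebraMap (algebraMap F B).injective (ringChar F)
    have hc : Commute R (algebraMap F B s) := (Algebra.commutes s R).symm
    rw [hD, hn, sub_pow_char_pow_of_commute _ _ hc, ← hn, ← map_pow, FiniteField.pow_card]
  have hRq : R ^ Fintype.card F = algebraMap F B s + algebraMap F B (-(-1) ^ k) * D := by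
    rw [← hDq, hfrob, add_sub_cancel]
  have hMpow : ∀ j, M ^ j = R ^ (2 * j) := by
    intro j
    rw [pow_mul, pow_two, hRR]
  rw [hMpow, oddHalf, hk2]
  split_ifs with hev
  · rw [hev.neg_one_pow, map_neg, map_one, neg_one_mul, hD] at hRq
    rw [show 2 * (k + 1) = Fintype.card F + 1 by omega, pow_succ', hRq]
    rw [← hRinv]
    congr 1
    rw [mul_smul, two_smul, Algebra.smul_def, mul_one]
    abel
  · rw [(Nat.not_even_iff_odd.1 hev).neg_one_pow, neg_neg, map_one, one_mul, hD,
      add_sub_cancel] at hRq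
    have hRinv' : ((2 * s) • 1 - R) * R = 1 := by
      rw [sub_mul, hR1, smul_mul_assoc, one_mul, sub_sub_cancel]
    have : R * R ^ (2 * k) = R * 1 := by
      rw [← pow_succ', ← hk, hRq, mul_one]
    calc R ^ (2 * k) = ((2 * s) • 1 - R) * (R * R ^ (2 * k)) := by
          rw [← mul_assoc, hRinv', one_mul]
      _ = 1 := by rw [this, mul_one, hRinv']

/-- Replacing M by -M exchanges c and 1 - c, and the exponent is odd. -/
theorem pow_oddHalf_eq_neg_one (hq : Odd (Fintype.card F)) {B : Type*} [Ring B] [Nontrivial B]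
    [Algebra F B] {c : F} (hc : ¬ IsSquare c) (hc' : IsSquare (1 - c)) {M : B}
    (hM : M * M = (4 * c - 2) • M - 1) : M ^ oddHalf (Fintype.card F) = -1 := by
  have h := pow_oddHalf_eq_one (M := -M) hq hc' (by rwa [sub_sub_cancel]) (by
    rw [neg_mul_neg, hM, smul_neg, ← neg_smul]
    congr 2
    ring)
  rw [(odd_oddHalf _).neg_pow] at h
  rw [← h, neg_neg]

/-- Multiplication by a fixed nonsquare embeds the nonzero squares into the nonsquares. -/
theorem card_le_nonsquares (hq : Odd (Fintype.card F)) :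
    Fintype.card F ≤ 1 + 2 * Nat.card {y : F // ¬ IsSquare y} := by
  classical
  obtain ⟨a, ha⟩ := FiniteField.exists_nonsquare (ringChar_ne_two_of_odd_card hq)
  have ha0 : a ≠ 0 := by rintro rfl; exact ha IsSquare.zero
  let f : F → Option ({y : F // ¬ IsSquare y} × Bool) := fun x =>
    if hx : IsSquare x then
      if hx0 : x = 0 then none else some (⟨a * x, fun h => ha (by
        have h2 := h.div hx
        rwa [mul_div_assoc, div_self hx0, mul_one] at h2)⟩, false)
    else some (⟨x, hx⟩, true)
  have hf : Function.Injective f := by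
    intro x y hxy
    simp only [f] at hxy
    split_ifs at hxy with h1 h2 h3 h4 h5 h6 h7 <;> simp_all
  have := Nat.card_le_card_of_injective f hf
  rw [Finite.card_option, Nat.card_prod] at this
  simp only [Nat.card_eq_fintype_card, Fintype.card_bool] at this ⊢
  omega

variable (F) in
/-- The parameters for which a product of two reflections has odd order. -/
abbrev SqNonsq : Type _ := {c : F // IsSquare c ∧ ¬ IsSquare (1 - c)}

variable (F) in
/-- The parameters for which a product of two reflections has order twice an odd number. -/
abbrev NonsqSq : Type _ := {c : F // ¬ IsSquare c ∧ IsSquare (1 - c)}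

variable (F) in
theorem card_nonsqSq : Nat.card (NonsqSq F) = Nat.card (SqNonsq F) :=
  Nat.card_congr
    { toFun := fun c => ⟨1 - c.1, c.2.2, by rw [sub_sub_cancel]; exact c.2.1⟩
      invFun := fun c => ⟨1 - c.1, c.2.2, by rw [sub_sub_cancel]; exact c.2.1⟩
      left_inv := fun c => by simp
      right_inv := fun c => by simp }

theorem isSquare_div_of_not (hq : Odd (Fintype.card F)) {a b : F} (ha : ¬ IsSquare a)
    (hb : ¬ IsSquare b) : IsSquare (a / b) := by
  classical
  have hchar := ringChar_ne_two_of_odd_card hq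
  have ha0 : a ≠ 0 := by rintro rfl; exact ha IsSquare.zero
  have hb0 : b ≠ 0 := by rintro rfl; exact hb IsSquare.zero
  rw [FiniteField.isSquare_iff hchar (div_ne_zero ha0 hb0), div_pow]
  rw [FiniteField.isSquare_iff hchar ha0] at ha
  rw [FiniteField.isSquare_iff hchar hb0] at hb
  rw [(FiniteField.pow_dichotomy hchar ha0).resolve_left ha,
    (FiniteField.pow_dichotomy hchar hb0).resolve_left hb, div_self]
  exact neg_ne_zero.2 one_ne_zero

/-- A nonsquare y other than -1 is sent to c = 1/(1 + y), for which 1 - c = y/(1 + y). Exactly one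
of c and 1 - c is then a square, according to whether 1 + y is one. The two kinds of parameter are
equinumerous under c ↦ 1 - c. -/
theorem card_le_card_sqNonsq (hq : Odd (Fintype.card F)) :
    Fintype.card F ≤ 3 + 4 * Nat.card (SqNonsq F) := by
  classical
  let f : {y : F // ¬ IsSquare y} → Option (SqNonsq F ⊕ NonsqSq F) := fun y =>
    if hy : 1 + y.1 = 0 then none else
      if hs : IsSquare (1 + y.1) then
        some (.inl ⟨(1 + y.1)⁻¹, hs.inv, fun h => y.2 (by
          have h2 := h.mul hs
          rwa [sub_mul, inv_mul_cancel₀ hy, one_mul, add_sub_cancel_left] at h2)⟩)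
      else
        some (.inr ⟨(1 + y.1)⁻¹, fun h => hs (by simpa using h.inv), by
          have h2 := isSquare_div_of_not hq y.2 hs
          have h3 : 1 - (1 + y.1)⁻¹ = y.1 / (1 + y.1) := by
            field_simp
            ring
          rwa [h3]⟩)
  have hf : Function.Injective f := by
    rintro ⟨x, hx⟩ ⟨y, hy⟩ hxy
    simp only [f] at hxy
    split_ifs at hxy with h1 h2 h3 h4 h5 h6 h7
    · exact Subtype.ext (add_left_cancel (h1.trans h2.symm))
    all_goals simp_all
  have h1 := Nat.card_le_card_of_injective f hf
  rw [Finite.card_option, Nat.card_sum, card_nonsqSq] at h1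
  have h2 := card_le_nonsquares hq
  omega

end TorusExponent

/-! ### Pairs of subspaces whose involutions generate a plane involution -/

section Good

variable {F A : Type*} [Field F] [Fintype F] [CommRing A] [StarRing A] [Algebra F A]
  {r r' k : Type*} [Fintype r] [DecidableEq r] [Fintype r'] [DecidableEq r'] [Fintype k]
  [DecidableEq k]

/-- Some power of the product of the involutions attached to the isometries `P` and `W` is the
involution attached to an isometry from the plane. -/
def IsGood (P W : Matrix r k A) : Prop :=
  ∃ (m : ℕ) (Z : Matrix r (Fin 2) A), Zᴴ * Z = 1 ∧
    (inflate P (-1) * inflate W (-1)) ^ m = inflate Z (-1)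

theorem isometry_mul {V : Matrix r' r A} (hV : Vᴴ * V = 1) {W : Matrix r k A} (hW : Wᴴ * W = 1) :
    (V * W)ᴴ * (V * W) = 1 := by
  rw [Matrix.conjTranspose_mul, Matrix.mul_assoc, ← Matrix.mul_assoc Vᴴ, hV, Matrix.one_mul, hW]

theorem IsGood.mul_left {P W : Matrix r k A} (h : IsGood P W) {V : Matrix r' r A}
    (hV : Vᴴ * V = 1) : IsGood (V * P) (V * W) := by
  obtain ⟨m, Z, hZ, hm⟩ := h
  refine ⟨m, V * Z, isometry_mul hV hZ, ?_⟩
  rw [inflate_mul_left, inflate_mul_left, inflate_mul_left, inflate_mul hV, inflate_pow hV, hm]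

/-- The involution depends only on the projection onto the image of `P`, not on the orthonormal
basis of that image. -/
theorem inflate_mul_unitary_neg_one (P : Matrix r k A) {b : Matrix k k A} (hb : b * bᴴ = 1) :
    inflate (P * b) (-1) = inflate P (-1) := by
  rw [inflate_neg_one, inflate_neg_one, Matrix.conjTranspose_mul, Matrix.mul_assoc,
    ← Matrix.mul_assoc b, hb, Matrix.one_mul]

theorem IsGood.mul_right {P W : Matrix r k A} (h : IsGood P W) {b b' : Matrix k k A}
    (hb : b * bᴴ = 1) (hb' : b' * b'ᴴ = 1) : IsGood (P * b) (W * b') := by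
  unfold IsGood
  rw [inflate_mul_unitary_neg_one P hb, inflate_mul_unitary_neg_one W hb']
  exact h

theorem inflate_submatrix (e : r' ≃ r) (P : Matrix r k A) (b : Matrix k k A) :
    inflate (P.submatrix e id) b = (inflate P b).submatrix e e := by
  ext i j
  simp [inflate, Matrix.mul_apply, Matrix.one_apply]

theorem IsGood.submatrix {P W : Matrix r k A} (h : IsGood P W) (e : r' ≃ r) :
    IsGood (P.submatrix e id) (W.submatrix e id) := by
  obtain ⟨m, Z, hZ, hm⟩ := h
  refine ⟨m, Z.submatrix e id, ?_, ?_⟩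
  · rw [Matrix.conjTranspose_submatrix, Matrix.submatrix_mul_equiv, hZ, Matrix.submatrix_id_id]
  · rw [inflate_submatrix, inflate_submatrix, inflate_submatrix, ← hm,
      Matrix.submatrix_mul_equiv]
    have := map_pow (Matrix.reindexAlgEquiv A A e.symm)
      (inflate P (-1) * inflate W (-1)) m
    simpa using this.symm

/-- The column vector `(d, e)`. -/
def planeVec (d e : A) : Matrix (Fin 2) (Fin 1) A := !![d; e]

theorem planeVec_mul_conjTranspose (d e d' e' : A) : planeVec d e * (planeVec d' e')ᴴ =
    !![d * star d', d * star e'; e * star d', e * star e'] := by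
  ext i j
  fin_cases i <;> fin_cases j <;> simp [planeVec, Matrix.mul_apply, Matrix.conjTranspose_apply]

/-- The product of the reflections in `(1, 0)` and in the unit vector `(d, e)`. -/
theorem reflection_mul_sq {c : F} {d e : A}
    (hd : star d * d = algebraMap F A c) (he : star e * e = algebraMap F A (1 - c)) :
    (inflate (planeVec (1 : A) 0) (-1) * inflate (planeVec d e) (-1)) *
      (inflate (planeVec (1 : A) 0) (-1) * inflate (planeVec d e) (-1)) =
    (4 * c - 2) • (inflate (planeVec (1 : A) 0) (-1) * inflate (planeVec d e) (-1)) - 1 := by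
  rw [map_sub, map_one] at he
  -- This matrix has trace 4c - 2 and determinant 1, so the claim is its Cayley–Hamilton relation.
  have hM : inflate (planeVec (1 : A) 0) (-1) * inflate (planeVec d e) (-1) =
      !![2 * algebraMap F A c - 1, 2 * (d * star e);
        - (2 * (e * star d)), 2 * algebraMap F A c - 1] := by
    rw [inflate_neg_one, inflate_neg_one, planeVec_mul_conjTranspose, planeVec_mul_conjTranspose]
    ext i j
    fin_cases i <;> fin_cases j <;>
      simp [Matrix.mul_apply, Fin.sum_univ_two, Matrix.one_apply]
    · linear_combination 2 * hd
    · ring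
    · linear_combination -2 * he
  have h4 : algebraMap F A (4 * c - 2) = 4 * algebraMap F A c - 2 := by
    simp only [map_sub, map_mul, map_ofNat]
  rw [hM, ← algebraMap_smul A (4 * c - 2), h4]
  ext i j
  fin_cases i <;> fin_cases j <;>
    simp [Matrix.mul_apply, Fin.sum_univ_two]
  · linear_combination (-4 * (star e * e)) * hd - 4 * algebraMap F A c * he
  · ring
  · ring
  · linear_combination (-4 * (star e * e)) * hd - 4 * algebraMap F A c * he

theorem inflate_neg_one_eq_mul {l : Type*} [Fintype l] [DecidableEq l] {P : Matrix r k A}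
    {u v : Matrix r l A} (h : P * Pᴴ = u * uᴴ + v * vᴴ) (huv : uᴴ * v = 0) :
    inflate P (-1) = inflate u (-1) * inflate v (-1) := by
  rw [inflate_neg_one, inflate_neg_one, inflate_neg_one, h, sub_mul, mul_sub, mul_sub,
    smul_mul_smul_comm]
  have : u * uᴴ * (v * vᴴ) = 0 := by
    calc _ = u * (uᴴ * v) * vᴴ := by simp only [Matrix.mul_assoc]
      _ = 0 := by simp [huv]
  rw [this]
  simp only [smul_add, one_mul, mul_one, smul_zero]
  abel

/-- Each of the two involutions is a product of a reflection in `B` and one in `C`. The factors over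
different planes commute, so the product is a rotation of `B` times a rotation of `C`. The chosen
power makes the first -1 and the second trivial. -/
theorem isGood_of_planes [Nontrivial A] (hq : Odd (Fintype.card F))
    {B C : Matrix r (Fin 2) A} (hB : Bᴴ * B = 1) (hC : Cᴴ * C = 1) (hBC : Bᴴ * C = 0)
    {c c' : F} (hc : ¬ IsSquare c ∧ IsSquare (1 - c)) (hc' : IsSquare c' ∧ ¬ IsSquare (1 - c'))
    {d e d' e' : A} (hd : star d * d = algebraMap F A c)
    (he : star e * e = algebraMap F A (1 - c)) (hd' : star d' * d' = algebraMap F A c')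
    (he' : star e' * e' = algebraMap F A (1 - c')) {P W : Matrix r k A}
    (hP : P * Pᴴ = (B * planeVec (1 : A) 0) * (B * planeVec (1 : A) 0)ᴴ + (C * planeVec (1 : A) 0) * (C * planeVec (1 : A) 0)ᴴ)
    (hW : W * Wᴴ = (B * planeVec d e) * (B * planeVec d e)ᴴ + (C * planeVec d' e') * (C * planeVec d' e')ᴴ) :
    IsGood P W := by
  have orth : ∀ a b : Matrix (Fin 2) (Fin 1) A, (B * a)ᴴ * (C * b) = 0 := by
    intro a b
    rw [Matrix.conjTranspose_mul, Matrix.mul_assoc, ← Matrix.mul_assoc Bᴴ, hBC]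
    simp
  refine ⟨oddHalf (Fintype.card F), B, hB, ?_⟩
  rw [inflate_neg_one_eq_mul hP (orth _ _), inflate_neg_one_eq_mul hW (orth _ _)]
  simp only [inflate_mul_left]
  have comm := fun a b => inflate_comm hBC a b
  rw [(comm _ _).symm.mul_mul_mul_comm, inflate_mul hB, inflate_mul hC, (comm _ _).mul_pow,
    inflate_pow hB, inflate_pow hC, pow_oddHalf_eq_neg_one hq hc.1 hc.2 (reflection_mul_sq hd he),
    pow_oddHalf_eq_one hq hc'.1 hc'.2 (reflection_mul_sq hd' he'), inflate_one, mul_one]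

theorem isGood_of_plane [Nontrivial A] (hq : Odd (Fintype.card F))
    {B : Matrix r (Fin 2) A} (hB : Bᴴ * B = 1)
    {c : F} (hc : ¬ IsSquare c ∧ IsSquare (1 - c))
    {d e : A} (hd : star d * d = algebraMap F A c)
    (he : star e * e = algebraMap F A (1 - c)) :
    IsGood (B * planeVec (1 : A) 0) (B * planeVec d e) := by
  refine ⟨oddHalf (Fintype.card F), B, hB, ?_⟩
  simp only [inflate_mul_left]
  rw [inflate_mul hB, inflate_pow hB,
    pow_oddHalf_eq_neg_one hq hc.1 hc.2 (reflection_mul_sq hd he)]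

end Good

/-! ### Counting isometries -/

section Counting

variable {F A : Type*} [Field F] [Fintype F] [CommRing A] [StarRing A] [Algebra F A]
  {r r' k k' : Type*} [Fintype r] [DecidableEq r] [Fintype r'] [DecidableEq r'] [Fintype k]
  [DecidableEq k] [Fintype k'] [DecidableEq k']

variable (A r k) in
/-- Isometries from `A ^ k` to `A ^ r` for the standard Hermitian forms. -/
abbrev Isom : Type _ := {W : Matrix r k A // Wᴴ * W = 1}

theorem card_isom_congr (e : r ≃ r') (f : k ≃ k') :
    Nat.card (Isom A r k) = Nat.card (Isom A r' k') := by
  refine Nat.card_congr ((Matrix.reindex e f).subtypeEquiv fun W => ?_)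
  rw [Matrix.conjTranspose_reindex, Matrix.reindex_apply, Matrix.reindex_apply,
    Matrix.submatrix_mul_equiv]
  constructor
  · intro h
    rw [h, Matrix.submatrix_one_equiv]
  · intro h
    have := congrArg (fun M => M.submatrix f f) h
    simpa using this

/-- For each unit vector w a unitary matrix taking the first basis vector to w is fixed. Its inverse
turns an isometry with first column w into a block matrix whose remaining block is an arbitrary
isometry of smaller size. -/
theorem card_isom_sum [Nontrivial A] (hA : QuadraticStar F A) :
    Nat.card (Isom A (Fin 1 ⊕ r) (Fin 1 ⊕ k)) =
      Nat.card (Isom A (Fin 1 ⊕ r) (Fin 1)) * Nat.card (Isom A r k) := by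
  set E : Matrix (Fin 1 ⊕ r) (Fin 1) A := Matrix.fromRows 1 0 with hE
  have hEE : Eᴴ * E = 1 := by
    rw [hE, Matrix.conjTranspose_fromRows_eq_fromCols_conjTranspose, Matrix.fromCols_mul_fromRows]
    simp
  have hex : ∀ w : Isom A (Fin 1 ⊕ r) (Fin 1), ∃ g ∈ Matrix.unitaryGroup (Fin 1 ⊕ r) A,
      g * E = w.1 := fun w => hA.exists_unitary_mul_eq hEE w.2 (by simp)
  choose g hg hgE using hex
  have hg1 : ∀ w, (g w)ᴴ * g w = 1 := fun w => (hg w).1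
  have hg2 : ∀ w, g w * (g w)ᴴ = 1 := fun w => (hg w).2
  let block : Matrix r k A → Matrix (Fin 1 ⊕ r) (Fin 1 ⊕ k) A := fun Y =>
    Matrix.fromBlocks 1 0 0 Y
  let Φ : Isom A (Fin 1 ⊕ r) (Fin 1) × Isom A r k → Isom A (Fin 1 ⊕ r) (Fin 1 ⊕ k) := fun p =>
    ⟨g p.1 * block p.2.1, by
      simp only [block]
      rw [Matrix.conjTranspose_mul, Matrix.mul_assoc, ← Matrix.mul_assoc _ (g p.1), hg1,
        Matrix.one_mul, Matrix.fromBlocks_conjTranspose, Matrix.fromBlocks_multiply, p.2.2]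
      simp⟩
  have hcol : ∀ p, (Φ p).1.toCols₁ = p.1.1 := by
    intro p
    have : block p.2.1 = Matrix.fromCols E (Matrix.fromRows 0 p.2.1) := by
      rw [hE, Matrix.fromCols_fromRows_eq_fromBlocks]
    simp only [Φ]
    rw [this, Matrix.mul_fromCols, Matrix.toCols₁_fromCols, hgE]
  rw [← Nat.card_prod]
  symm
  refine Nat.card_congr (Equiv.ofBijective Φ ⟨?_, ?_⟩)
  · rintro ⟨w, Y⟩ ⟨w', Y'⟩ h
    have hw : w = w' := by
      apply Subtype.ext
      rw [← hcol (w, Y), h, hcol]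
    subst hw
    have h1 : g w * block Y.1 = g w * block Y'.1 :=
      congrArg Subtype.val h
    have h2 := congrArg (fun M => (g w)ᴴ * M) h1
    simp only [← Matrix.mul_assoc, hg1, Matrix.one_mul] at h2
    rw [Prod.mk.injEq]
    exact ⟨rfl, Subtype.ext (Matrix.fromBlocks_inj.1 h2).2.2.2⟩
  · intro V
    have hw : (V.1.toCols₁)ᴴ * V.1.toCols₁ = 1 := by
      have h := V.2
      rw [← Matrix.fromCols_toCols V.1, Matrix.conjTranspose_fromCols_eq_fromRows_conjTranspose,
        Matrix.fromRows_mul_fromCols] at h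
      exact (Matrix.fromBlocks_inj.1 (h.trans Matrix.fromBlocks_one.symm)).1
    set w : Isom A (Fin 1 ⊕ r) (Fin 1) := ⟨V.1.toCols₁, hw⟩ with hwdef
    set V' := (g w)ᴴ * V.1 with hV'
    have hiso : V'ᴴ * V' = 1 := by
      rw [hV', Matrix.conjTranspose_mul, Matrix.conjTranspose_conjTranspose, Matrix.mul_assoc,
        ← Matrix.mul_assoc (g w), hg2, Matrix.one_mul, V.2]
    have hfirst : V'.toCols₁ = E := by
      have h1 : V' = Matrix.fromCols ((g w)ᴴ * V.1.toCols₁) ((g w)ᴴ * V.1.toCols₂) := by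
        rw [← Matrix.mul_fromCols, Matrix.fromCols_toCols]
      rw [h1, Matrix.toCols₁_fromCols]
      have h2 := hgE w
      rw [hwdef] at h2
      simp only at h2
      rw [← h2, ← Matrix.mul_assoc, hg1, Matrix.one_mul]
    have hV2 : V' = Matrix.fromBlocks 1 V'.toCols₂.toRows₁ 0 V'.toCols₂.toRows₂ := by
      rw [← Matrix.fromCols_fromRows_eq_fromBlocks, Matrix.fromRows_toRows, ← hE, ← hfirst,
        Matrix.fromCols_toCols]
    rw [hV2, Matrix.fromBlocks_conjTranspose, Matrix.fromBlocks_multiply,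
      ← Matrix.fromBlocks_one, Matrix.fromBlocks_inj] at hiso
    obtain ⟨-, h12, -, h22⟩ := hiso
    simp only [Matrix.conjTranspose_one, Matrix.one_mul, Matrix.conjTranspose_zero,
      Matrix.zero_mul, add_zero] at h12
    rw [h12] at h22 hV2
    simp only [Matrix.conjTranspose_zero, Matrix.zero_mul, zero_add] at h22
    refine ⟨(w, ⟨V'.toCols₂.toRows₂, h22⟩), Subtype.ext ?_⟩
    simp only [Φ, block]
    rw [← hV2, hV', ← Matrix.mul_assoc, hg2, Matrix.one_mul]

theorem card_isom_two [Nontrivial A] (hA : QuadraticStar F A) (n : ℕ) :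
    Nat.card (Isom A (Fin (n + 1)) (Fin 2)) =
      Nat.card (Isom A (Fin (n + 1)) (Fin 1)) * Nat.card (Isom A (Fin n) (Fin 1)) := by
  have e : Fin (n + 1) ≃ Fin 1 ⊕ Fin n := (finSumFinEquiv.trans (finCongr (by omega))).symm
  have f : Fin 2 ≃ Fin 1 ⊕ Fin 1 := (finSumFinEquiv (m := 1) (n := 1)).symm
  rw [card_isom_congr e f, card_isom_sum hA, card_isom_congr e.symm (Equiv.refl _)]

theorem card_le_of_fiber_injective {X Y T : Type*} [Finite Y] [Finite T] (f : X → Y)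
    (h : ∀ y, ∃ g : {x // f x = y} → T, Function.Injective g) :
    Nat.card X ≤ Nat.card Y * Nat.card T := by
  choose g hg using h
  rw [← Nat.card_congr (Equiv.sigmaFiberEquiv f), ← Nat.card_prod]
  refine Nat.card_le_card_of_injective (fun p => (p.1, g p.1 p.2)) ?_
  rintro ⟨y, x⟩ ⟨y', x'⟩ h
  simp only [Prod.mk.injEq] at h
  obtain ⟨rfl, h⟩ := h
  rw [hg y h]

end Counting

/-! ### Lower bounds for the number of good isometries -/

section GoodCount

variable {F A : Type*} [Field F] [Fintype F] [CommRing A] [StarRing A] [Algebra F A]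
  {κ : Type*} [Fintype κ] [DecidableEq κ]

variable (A) in
/-- The inclusion of the coordinate plane spanned by the first vectors of the two summands. -/
def firstPlane : Matrix (Fin 2 ⊕ Fin 2) (Fin 2) A :=
  Matrix.fromRows !![1, 0; 0, 0] !![0, 1; 0, 0]

variable (A) in
/-- The inclusion of the coordinate plane spanned by the second vectors of the two summands. -/
def secondPlane : Matrix (Fin 2 ⊕ Fin 2) (Fin 2) A :=
  Matrix.fromRows !![0, 0; 1, 0] !![0, 0; 0, 1]

theorem conjTranspose_two (a b c d : A) :
    (!![a, b; c, d])ᴴ = !![star a, star c; star b, star d] := by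
  ext i j
  fin_cases i <;> fin_cases j <;> rfl

theorem firstPlane_isometry : (firstPlane A)ᴴ * firstPlane A = 1 := by
  simp only [firstPlane, Matrix.conjTranspose_fromRows_eq_fromCols_conjTranspose,
    Matrix.fromCols_mul_fromRows, conjTranspose_two, Matrix.mul_fin_two, Matrix.one_fin_two]
  simp

theorem secondPlane_isometry : (secondPlane A)ᴴ * secondPlane A = 1 := by
  simp only [secondPlane, Matrix.conjTranspose_fromRows_eq_fromCols_conjTranspose,
    Matrix.fromCols_mul_fromRows, conjTranspose_two, Matrix.mul_fin_two, Matrix.one_fin_two]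
  simp

theorem firstPlane_orthogonal : (firstPlane A)ᴴ * secondPlane A = 0 := by
  simp only [firstPlane, secondPlane, Matrix.conjTranspose_fromRows_eq_fromCols_conjTranspose,
    Matrix.fromCols_mul_fromRows, conjTranspose_two, Matrix.mul_fin_two]
  simpa using (Matrix.eta_fin_two (0 : Matrix (Fin 2) (Fin 2) A)).symm

theorem firstPlane_mul (d e : A) :
    firstPlane A * planeVec d e = Matrix.fromRows (planeVec d 0) (planeVec e 0) := by
  rw [firstPlane, Matrix.fromRows_mul]
  congr 1 <;> ext i j <;> fin_cases i <;> simp [planeVec, Matrix.mul_apply]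

theorem secondPlane_mul (d e : A) :
    secondPlane A * planeVec d e = Matrix.fromRows (planeVec 0 d) (planeVec 0 e) := by
  rw [secondPlane, Matrix.fromRows_mul]
  congr 1 <;> ext i j <;> fin_cases i <;> simp [planeVec, Matrix.mul_apply]

theorem diagonal_fromRows_outer (d d' e e' : A) :
    (Matrix.fromRows (Matrix.diagonal ![d, d']) (Matrix.diagonal ![e, e'])) *
      (Matrix.fromRows (Matrix.diagonal ![d, d']) (Matrix.diagonal ![e, e']))ᴴ =
    (firstPlane A * planeVec d e) * (firstPlane A * planeVec d e)ᴴ +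
      (secondPlane A * planeVec d' e') * (secondPlane A * planeVec d' e')ᴴ := by
  simp only [firstPlane_mul, secondPlane_mul,
    Matrix.conjTranspose_fromRows_eq_fromCols_conjTranspose, Matrix.fromRows_mul_fromCols,
    Matrix.fromBlocks_add, planeVec_mul_conjTranspose, Matrix.diagonal_conjTranspose,
    Matrix.diagonal_mul_diagonal]
  congr 1 <;> ext i j <;> fin_cases i <;> fin_cases j <;> simp

theorem isGood_diagonal [Nontrivial A] (hq : Odd (Fintype.card F))
    {c c' : F} (hc : ¬ IsSquare c ∧ IsSquare (1 - c)) (hc' : IsSquare c' ∧ ¬ IsSquare (1 - c'))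
    {d e d' e' : A} (hd : star d * d = algebraMap F A c)
    (he : star e * e = algebraMap F A (1 - c)) (hd' : star d' * d' = algebraMap F A c')
    (he' : star e' * e' = algebraMap F A (1 - c')) :
    IsGood (Matrix.fromRows 1 0 : Matrix (Fin 2 ⊕ Fin 2) (Fin 2) A)
      (Matrix.fromRows (Matrix.diagonal ![d, d']) (Matrix.diagonal ![e, e'])) := by
  refine isGood_of_planes hq firstPlane_isometry secondPlane_isometry firstPlane_orthogonal
    hc hc' hd he hd' he' ?_ (diagonal_fromRows_outer d d' e e')
  rw [← diagonal_fromRows_outer]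
  have h1 : Matrix.diagonal ![(1 : A), 1] = 1 := by
    rw [← Matrix.diagonal_one]
    congr 1
    ext i
    fin_cases i <;> rfl
  have h0 : Matrix.diagonal ![(0 : A), 0] = 0 := by
    rw [← Matrix.diagonal_zero]
    congr 1
    ext i
    fin_cases i <;> rfl
  rw [h1, h0]

theorem fromBlocks_isometry {l m k' m' : Type*} [Fintype l] [Fintype m] [Fintype k'] [Fintype m']
    [DecidableEq l] [DecidableEq m] [DecidableEq k'] [DecidableEq m']
    {U : Matrix l k' A} {Y : Matrix m m' A} (hU : Uᴴ * U = 1) (hY : Yᴴ * Y = 1) :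
    (Matrix.fromBlocks U 0 0 Y)ᴴ * Matrix.fromBlocks U 0 0 Y = 1 := by
  rw [Matrix.fromBlocks_conjTranspose, Matrix.fromBlocks_multiply, hU, hY]
  simp

/-- This is the diagonal case moved by the isometry with blocks `U` and `Y`. That isometry takes the
reference plane to the image of `U` in the first summand, which is the reference plane with another
basis; the factor `Uᴴ` on the right restores the basis. -/
theorem isGood_fromRows [Nontrivial A] (hq : Odd (Fintype.card F))
    {c c' : F} (hc : ¬ IsSquare c ∧ IsSquare (1 - c)) (hc' : IsSquare c' ∧ ¬ IsSquare (1 - c'))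
    {d e d' e' : A} (hd : star d * d = algebraMap F A c)
    (he : star e * e = algebraMap F A (1 - c)) (hd' : star d' * d' = algebraMap F A c')
    (he' : star e' * e' = algebraMap F A (1 - c')) {U U' : Matrix (Fin 2) (Fin 2) A}
    (hU : Uᴴ * U = 1) (hU' : U'ᴴ * U' = 1) {Y : Matrix κ (Fin 2) A} (hY : Yᴴ * Y = 1) :
    IsGood (Matrix.fromRows 1 0 : Matrix (Fin 2 ⊕ κ) (Fin 2) A)
      (Matrix.fromRows (U * Matrix.diagonal ![d, d'] * U')
        (Y * Matrix.diagonal ![e, e'] * U')) := by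
  have hUU : U * Uᴴ = 1 := mul_eq_one_comm.1 hU
  have hUU' : U' * U'ᴴ = 1 := mul_eq_one_comm.1 hU'
  have h := ((isGood_diagonal hq hc hc' hd he hd' he').mul_left
    (fromBlocks_isometry hU hY)).mul_right (b := Uᴴ) (b' := U') (by simpa using hU) hUU'
  simp only [Matrix.fromBlocks_mul_fromRows, Matrix.fromRows_mul] at h
  simpa [hUU] using h

theorem QuadraticStar.exists_norm (hA : QuadraticStar F A) (c : F) :
    ∃ d : A, star d * d = algebraMap F A c := by
  by_cases hc : c = 0
  · exact ⟨0, by simp [hc]⟩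
  · exact hA.exists_norm_eq c hc

theorem isUnit_of_norm {c : F} (hc : c ≠ 0) {d : A} (hd : star d * d = algebraMap F A c) :
    IsUnit d := by
  have h : IsUnit (star d * d) := by
    rw [hd]
    exact (IsUnit.mk0 c hc).map (algebraMap F A)
  exact isUnit_of_mul_isUnit_right h

theorem eq_zero_of_smul_eq_smul {a b : F} (hab : a ≠ b) {x : A}
    (h : algebraMap F A a * x = x * algebraMap F A b) : x = 0 := by
  have h1 : algebraMap F A (a - b) * x = 0 := by
    rw [map_sub, sub_mul, h, mul_comm, sub_self]
  have h2 := ((IsUnit.mk0 _ (sub_ne_zero.2 hab)).map (algebraMap F A)).mul_right_eq_zero.1 h1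
  exact h2

theorem conjTranspose_diagonal_two {d d' : A} {c c' : F} (hd : star d * d = algebraMap F A c)
    (hd' : star d' * d' = algebraMap F A c') :
    (Matrix.diagonal ![d, d'])ᴴ * Matrix.diagonal ![d, d'] =
      Matrix.diagonal ![algebraMap F A c, algebraMap F A c'] := by
  ext i j
  fin_cases i <;> fin_cases j <;>
    simp [Matrix.diagonal_conjTranspose, hd, hd']

theorem nonsqSq_ne_sqNonsq (c : NonsqSq F) (c' : SqNonsq F) : c.1 ≠ c'.1 := fun h =>
  c.2.1 (h ▸ c'.2.1)

/-- A unitary matrix that intertwines two diagonal matrices with spectral data of distinct kinds is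
diagonal, and the two diagonal matrices agree. -/
theorem diagonal_of_intertwine [Nontrivial A] {c₁ c₂ : NonsqSq F} {c₁' c₂' : SqNonsq F}
    {τ : Matrix (Fin 2) (Fin 2) A} (hτ : τᴴ * τ = 1)
    (h : Matrix.diagonal ![algebraMap F A c₁.1, algebraMap F A c₁'.1] * τ =
      τ * Matrix.diagonal ![algebraMap F A c₂.1, algebraMap F A c₂'.1]) :
    τ 0 1 = 0 ∧ τ 1 0 = 0 ∧ star (τ 0 0) * τ 0 0 = 1 ∧ star (τ 1 1) * τ 1 1 = 1 ∧
      c₁ = c₂ ∧ c₁' = c₂' := by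
  have h01 : τ 0 1 = 0 := eq_zero_of_smul_eq_smul (nonsqSq_ne_sqNonsq c₁ c₂') (by
    simpa [Matrix.diagonal_mul, Matrix.mul_diagonal] using congrFun₂ h 0 1)
  have h10 : τ 1 0 = 0 := eq_zero_of_smul_eq_smul (nonsqSq_ne_sqNonsq c₂ c₁').symm (by
    simpa [Matrix.diagonal_mul, Matrix.mul_diagonal] using congrFun₂ h 1 0)
  have h00 : star (τ 0 0) * τ 0 0 = 1 := by
    simpa [Matrix.mul_apply, Fin.sum_univ_two, h10] using congrFun₂ hτ 0 0
  have h11 : star (τ 1 1) * τ 1 1 = 1 := by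
    simpa [Matrix.mul_apply, Fin.sum_univ_two, h01] using congrFun₂ hτ 1 1
  refine ⟨h01, h10, h00, h11, ?_, ?_⟩
  · by_contra hne
    have : τ 0 0 = 0 := eq_zero_of_smul_eq_smul (fun h => hne (Subtype.ext h)) (by
      simpa [Matrix.diagonal_mul, Matrix.mul_diagonal] using congrFun₂ h 0 0)
    simp [this] at h00
  · by_contra hne
    have : τ 1 1 = 0 := eq_zero_of_smul_eq_smul (fun h => hne (Subtype.ext h)) (by
      simpa [Matrix.diagonal_mul, Matrix.mul_diagonal] using congrFun₂ h 1 1)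
    simp [this] at h11

/-- The `1 × 1` isometry with the given entry. -/
def scalarIsom (a : A) (ha : star a * a = 1) : Isom A (Fin 1) (Fin 1) :=
  ⟨Matrix.of fun _ _ => a, by
    ext i j
    rw [Subsingleton.elim i j]
    simp [Matrix.mul_apply, ha]⟩

theorem scalarIsom_inj {a b : A} {ha : star a * a = 1} {hb : star b * b = 1}
    (h : scalarIsom a ha = scalarIsom b hb) : a = b :=
  congrFun₂ (congrArg Subtype.val h) 0 0

instance [Finite A] {r k : Type*} [Finite r] [Fintype r] [Finite k] [DecidableEq k] :
    Finite (Isom A r k) := by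
  have : Finite (Matrix r k A) := inferInstanceAs (Finite (r → k → A))
  infer_instance

theorem isUnit_diagonal_two {d d' : A} (hd : IsUnit d) (hd' : IsUnit d') :
    IsUnit (Matrix.diagonal ![d, d']) := by
  rw [Matrix.isUnit_iff_isUnit_det, Matrix.det_diagonal, Fin.prod_univ_two]
  exact hd.mul hd'

theorem cancel_right_of_isUnit {m : Type*} {X Y : Matrix m (Fin 2) A}
    {D : Matrix (Fin 2) (Fin 2) A} (hD : IsUnit D) (h : X * D = Y * D) : X = Y := by
  obtain ⟨u, rfl⟩ := hD
  have := congrArg (fun M => M * (u⁻¹).1) h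
  simpa [Matrix.mul_assoc] using this

/-- Good isometries are produced as (U D U', Y D' U') from parameters c, c', unitary U, U' and an
isometry Y, where D and D' have entries of norms c, c' and 1 - c, 1 - c'. The only ambiguity is a
pair of unit scalars, because c ≠ c' forces any change of U to be diagonal. -/
theorem card_good_planes [Nontrivial A] [Finite A] (hA : QuadraticStar F A)
    (hq : Odd (Fintype.card F)) :
    Nat.card (NonsqSq F) * Nat.card (SqNonsq F) * Nat.card (Isom A (Fin 2) (Fin 1)) ^ 2 *
      Nat.card (Isom A κ (Fin 2)) ≤
    Nat.card {W : Isom A (Fin 2 ⊕ κ) (Fin 2) // IsGood (Matrix.fromRows 1 0) W.1} := by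
  choose δ hδ using hA.exists_norm
  let D : NonsqSq F → SqNonsq F → Matrix (Fin 2) (Fin 2) A := fun c c' =>
    Matrix.diagonal ![δ c.1, δ c'.1]
  let D' : NonsqSq F → SqNonsq F → Matrix (Fin 2) (Fin 2) A := fun c c' =>
    Matrix.diagonal ![δ (1 - c.1), δ (1 - c'.1)]
  have hne : ∀ c : NonsqSq F, c.1 ≠ 0 ∧ 1 - c.1 ≠ 0 := fun c =>
    ⟨fun h => c.2.1 (h ▸ IsSquare.zero), fun h => c.2.1 (by
      rw [← sub_eq_zero.1 h]; exact IsSquare.one)⟩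
  have hne' : ∀ c : SqNonsq F, c.1 ≠ 0 ∧ 1 - c.1 ≠ 0 := fun c =>
    ⟨fun h => c.2.2 (by rw [h, sub_zero]; exact IsSquare.one), fun h => c.2.2 (h ▸ IsSquare.zero)⟩
  have hDu : ∀ c c', IsUnit (D c c') := fun c c' =>
    isUnit_diagonal_two (isUnit_of_norm (hne c).1 (hδ _)) (isUnit_of_norm (hne' c').1 (hδ _))
  have hDu' : ∀ c c', IsUnit (D' c c') := fun c c' =>
    isUnit_diagonal_two (isUnit_of_norm (hne c).2 (hδ _)) (isUnit_of_norm (hne' c').2 (hδ _))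
  have hDD : ∀ c c', D c c' * (D c c')ᴴ =
      Matrix.diagonal ![algebraMap F A c.1, algebraMap F A c'.1] := by
    intro c c'
    rw [← conjTranspose_diagonal_two (hδ c.1) (hδ c'.1)]
    simp only [D, Matrix.diagonal_conjTranspose, Matrix.diagonal_mul_diagonal, mul_comm]
  let X := (NonsqSq F × SqNonsq F) × (Isom A (Fin 2) (Fin 2) × Isom A (Fin 2) (Fin 2)) ×
    Isom A κ (Fin 2)
  let f : X → {W : Isom A (Fin 2 ⊕ κ) (Fin 2) // IsGood (Matrix.fromRows 1 0) W.1} := fun p =>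
    ⟨⟨Matrix.fromRows (p.2.1.1.1 * D p.1.1 p.1.2 * p.2.1.2.1)
        (p.2.2.1 * D' p.1.1 p.1.2 * p.2.1.2.1), by
      rw [Matrix.conjTranspose_fromRows_eq_fromCols_conjTranspose, Matrix.fromCols_mul_fromRows]
      have h1 : (p.2.1.1.1 * D p.1.1 p.1.2 * p.2.1.2.1)ᴴ *
          (p.2.1.1.1 * D p.1.1 p.1.2 * p.2.1.2.1) =
          p.2.1.2.1ᴴ * ((D p.1.1 p.1.2)ᴴ * (p.2.1.1.1ᴴ * p.2.1.1.1) * D p.1.1 p.1.2) *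
            p.2.1.2.1 := by
        simp only [Matrix.conjTranspose_mul, Matrix.mul_assoc]
      have h2 : (p.2.2.1 * D' p.1.1 p.1.2 * p.2.1.2.1)ᴴ *
          (p.2.2.1 * D' p.1.1 p.1.2 * p.2.1.2.1) =
          p.2.1.2.1ᴴ * ((D' p.1.1 p.1.2)ᴴ * (p.2.2.1ᴴ * p.2.2.1) * D' p.1.1 p.1.2) *
            p.2.1.2.1 := by
        simp only [Matrix.conjTranspose_mul, Matrix.mul_assoc]
      rw [h1, h2, p.2.1.1.2, p.2.2.2, Matrix.mul_one, Matrix.mul_one,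
        conjTranspose_diagonal_two (hδ _) (hδ _), conjTranspose_diagonal_two (hδ _) (hδ _),
        ← Matrix.add_mul, ← Matrix.mul_add, Matrix.diagonal_add]
      have h3 : (Matrix.diagonal fun i => (![algebraMap F A p.1.1.1, algebraMap F A p.1.2.1] :
          Fin 2 → A) i + (![algebraMap F A (1 - p.1.1.1), algebraMap F A (1 - p.1.2.1)] :
          Fin 2 → A) i) = 1 := by
        rw [← Matrix.diagonal_one]
        congr 1
        ext i
        fin_cases i <;> simp
      rw [h3, Matrix.mul_one, p.2.1.2.2]⟩,
      isGood_fromRows hq p.1.1.2 p.1.2.2 (hδ _) (hδ _) (hδ _) (hδ _) p.2.1.1.2 p.2.1.2.2 p.2.2.2⟩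
  -- The upper block times its adjoint is U diag(c, c') Uᴴ. Hence for two parameter sets with the
  -- same value, τ = Uᴴ U' intertwines the two diagonal matrices.
  have key : ∀ p p' : X, f p = f p' → ∀ τ, p.2.1.1.1ᴴ * p'.2.1.1.1 = τ →
      τ 0 1 = 0 ∧ τ 1 0 = 0 ∧ star (τ 0 0) * τ 0 0 = 1 ∧ star (τ 1 1) * τ 1 1 = 1 ∧
        p.1.1 = p'.1.1 ∧ p.1.2 = p'.1.2 := by
    rintro ⟨⟨c, c'⟩, ⟨U, V⟩, Y⟩ ⟨⟨b, b'⟩, ⟨U', V'⟩, Y'⟩ h τ rfl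
    have h1 : U.1 * D c c' * V.1 = U'.1 * D b b' * V'.1 :=
      ((Matrix.fromRows_ext_iff _ _ _ _).1 (congrArg (fun W => W.1.1) h)).1
    have hU : U.1 * U.1ᴴ = 1 := mul_eq_one_comm.1 U.2
    have hU' : U'.1 * U'.1ᴴ = 1 := mul_eq_one_comm.1 U'.2
    have hV : V.1 * V.1ᴴ = 1 := mul_eq_one_comm.1 V.2
    have hV' : V'.1 * V'.1ᴴ = 1 := mul_eq_one_comm.1 V'.2
    have h2 : U.1 * Matrix.diagonal ![algebraMap F A c.1, algebraMap F A c'.1] * U.1ᴴ =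
        U'.1 * Matrix.diagonal ![algebraMap F A b.1, algebraMap F A b'.1] * U'.1ᴴ := by
      rw [← hDD, ← hDD]
      calc _ = (U.1 * D c c' * V.1) * (U.1 * D c c' * V.1)ᴴ := by
            calc _ = U.1 * D c c' * (V.1 * V.1ᴴ) * (D c c')ᴴ * U.1ᴴ := by
                  rw [hV]; simp only [Matrix.mul_assoc, Matrix.one_mul]
              _ = _ := by simp only [Matrix.conjTranspose_mul, Matrix.mul_assoc]
        _ = (U'.1 * D b b' * V'.1) * (U'.1 * D b b' * V'.1)ᴴ := by rw [h1]
        _ = _ := by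
            calc _ = U'.1 * D b b' * (V'.1 * V'.1ᴴ) * (D b b')ᴴ * U'.1ᴴ := by
                  simp only [Matrix.conjTranspose_mul, Matrix.mul_assoc]
              _ = _ := by rw [hV']; simp only [Matrix.mul_assoc, Matrix.one_mul]
    refine diagonal_of_intertwine ?_ ?_
    · calc _ = U'.1ᴴ * (U.1 * U.1ᴴ) * U'.1 := by
            simp only [Matrix.conjTranspose_mul, Matrix.conjTranspose_conjTranspose,
              Matrix.mul_assoc]
        _ = 1 := by rw [hU, Matrix.mul_one, U'.2]
    · calc _ = (U.1ᴴ * U.1) * Matrix.diagonal ![algebraMap F A c.1, algebraMap F A c'.1] *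
            U.1ᴴ * U'.1 := by rw [U.2]; simp only [Matrix.mul_assoc, Matrix.one_mul]
        _ = U.1ᴴ * (U.1 * Matrix.diagonal ![algebraMap F A c.1, algebraMap F A c'.1] * U.1ᴴ) *
            U'.1 := by simp only [Matrix.mul_assoc]
        _ = U.1ᴴ * U'.1 * Matrix.diagonal ![algebraMap F A b.1, algebraMap F A b'.1] *
            (U'.1ᴴ * U'.1) := by rw [h2]; simp only [Matrix.mul_assoc]
        _ = _ := by rw [U'.2, Matrix.mul_one]
  have hcard : Nat.card X ≤ Nat.card {W : Isom A (Fin 2 ⊕ κ) (Fin 2) //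
      IsGood (Matrix.fromRows 1 0) W.1} *
      Nat.card (Isom A (Fin 1) (Fin 1) × Isom A (Fin 1) (Fin 1)) := by
    -- Within a fibre, the diagonal entries of τ relative to a base point determine U. Then U' and Y
    -- follow because D, D' and the unitary factors are invertible.
    refine card_le_of_fiber_injective f fun y => ?_
    by_cases hy : ∃ p₀, f p₀ = y
    · obtain ⟨p₀, rfl⟩ := hy
      refine ⟨fun p => (scalarIsom _ (key p₀ p.1 p.2.symm _ rfl).2.2.1,
        scalarIsom _ (key p₀ p.1 p.2.symm _ rfl).2.2.2.1), ?_⟩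
      rintro ⟨p, hp⟩ ⟨p', hp'⟩ h
      rw [Prod.mk.injEq] at h
      have h0 := scalarIsom_inj h.1
      have h1 := scalarIsom_inj h.2
      obtain ⟨a1, a2, -, -, a3, a4⟩ := key p₀ p hp.symm _ rfl
      obtain ⟨b1, b2, -, -, b3, b4⟩ := key p₀ p' hp'.symm _ rfl
      have hτ : p₀.2.1.1.1ᴴ * p.2.1.1.1 = p₀.2.1.1.1ᴴ * p'.2.1.1.1 := by
        ext i j
        fin_cases i <;> fin_cases j
        · exact h0
        · exact a1.trans b1.symm
        · exact a2.trans b2.symm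
        · exact h1
      have hU : p.2.1.1.1 = p'.2.1.1.1 := by
        have h2 := congrArg (fun M => p₀.2.1.1.1 * M) hτ
        simpa only [← Matrix.mul_assoc, mul_eq_one_comm.1 p₀.2.1.1.2, Matrix.one_mul] using h2
      have hpp : f p = f p' := hp.trans hp'.symm
      obtain ⟨⟨c, c'⟩, ⟨U, V⟩, Y⟩ := p
      obtain ⟨⟨b, b'⟩, ⟨U', V'⟩, Y'⟩ := p'
      obtain rfl : c = b := a3.symm.trans b3
      obtain rfl : c' = b' := a4.symm.trans b4
      obtain rfl : U = U' := Subtype.ext hU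
      have hr := (Matrix.fromRows_ext_iff _ _ _ _).1 (congrArg (fun W => W.1.1) hpp)
      have hUD : IsUnit (U.1 * D c c') :=
        (IsUnit.of_mul_eq_one _ (mul_eq_one_comm.1 U.2)).mul (hDu c c')
      obtain rfl : V = V' := Subtype.ext (hUD.mul_left_cancel hr.1)
      have hVu : IsUnit V.1 := IsUnit.of_mul_eq_one _ (mul_eq_one_comm.1 V.2)
      obtain rfl : Y = Y' := Subtype.ext
        (cancel_right_of_isUnit (hDu' c c') (cancel_right_of_isUnit hVu hr.2))
      rfl
    · have : IsEmpty {x // f x = y} := ⟨fun x => hy ⟨x.1, x.2⟩⟩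
      exact ⟨fun x => this.elim x, fun x => this.elim x⟩
  have h22 := card_isom_two hA 1
  simp only [X, Nat.card_prod] at hcard
  rw [show (1 + 1 : ℕ) = 2 from rfl] at h22
  rw [h22] at hcard
  have hpos : 0 < Nat.card (Isom A (Fin 1) (Fin 1)) := by
    have : Nonempty (Isom A (Fin 1) (Fin 1)) := ⟨scalarIsom 1 (by simp)⟩
    exact Nat.card_pos
  -- Each of the two factors counting 2 × 2 isometries equals the number of unit vectors of rank 2
  -- times that of rank 1; the rank 1 factors cancel the ambiguity.
  refine Nat.le_of_mul_le_mul_right (le_trans (le_of_eq ?_) hcard) (Nat.mul_pos hpos hpos)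
  ring

/-- A unit vector is assembled from its component along the reference line, of norm c, and a
multiple of a unit vector `Y` in the complement. Both lines lie in one plane, where the rotation
power is -1. The parameter c is recovered as the norm of the first coordinate, so the map is
injective. -/
theorem card_good_lines [Nontrivial A] [Finite A] (hA : QuadraticStar F A)
    (hq : Odd (Fintype.card F)) :
    Nat.card (NonsqSq F) * Nat.card (Isom A (Fin 1) (Fin 1)) * Nat.card (Isom A κ (Fin 1)) ≤
    Nat.card {W : Isom A (Fin 1 ⊕ κ) (Fin 1) // IsGood (Matrix.fromRows 1 0) W.1} := by
  choose δ hδ using hA.exists_norm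
  have hne : ∀ c : NonsqSq F, c.1 ≠ 0 ∧ 1 - c.1 ≠ 0 := fun c =>
    ⟨fun h => c.2.1 (h ▸ IsSquare.zero), fun h => c.2.1 (by
      rw [← sub_eq_zero.1 h]; exact IsSquare.one)⟩
  have hentry : ∀ a : Isom A (Fin 1) (Fin 1), star (a.1 0 0) * a.1 0 0 = 1 := by
    intro a
    simpa [Matrix.mul_apply] using congrFun₂ a.2 0 0
  have hnorm : ∀ (c : F) (a : Isom A (Fin 1) (Fin 1)),
      star (δ c * a.1 0 0) * (δ c * a.1 0 0) = algebraMap F A c := by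
    intro c a
    rw [star_mul]
    linear_combination star (a.1 0 0) * a.1 0 0 * hδ c + algebraMap F A c * hentry a
  rw [← Nat.card_prod, ← Nat.card_prod]
  let f : (NonsqSq F × Isom A (Fin 1) (Fin 1)) × Isom A κ (Fin 1) →
      {W : Isom A (Fin 1 ⊕ κ) (Fin 1) // IsGood (Matrix.fromRows 1 0) W.1} := fun p =>
    ⟨⟨Matrix.fromRows (δ p.1.1.1 • p.1.2.1) (δ (1 - p.1.1.1) • p.2.1), by
      rw [Matrix.conjTranspose_fromRows_eq_fromCols_conjTranspose, Matrix.fromCols_mul_fromRows,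
        Matrix.conjTranspose_smul, Matrix.conjTranspose_smul, smul_mul_smul_comm,
        Matrix.smul_mul, Matrix.mul_smul, smul_smul, p.1.2.2, p.2.2, hδ, hδ, ← add_smul, ← map_add,
        add_sub_cancel, map_one, one_smul]⟩, by
      have hB : (Matrix.fromRows (!![1, 0] : Matrix (Fin 1) (Fin 2) A)
          (p.2.1 * (!![0, 1] : Matrix (Fin 1) (Fin 2) A)))ᴴ * Matrix.fromRows
          (!![1, 0] : Matrix (Fin 1) (Fin 2) A)
          (p.2.1 * (!![0, 1] : Matrix (Fin 1) (Fin 2) A)) = 1 := by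
        rw [Matrix.conjTranspose_fromRows_eq_fromCols_conjTranspose, Matrix.fromCols_mul_fromRows,
          Matrix.conjTranspose_mul, Matrix.mul_assoc, ← Matrix.mul_assoc _ p.2.1, p.2.2]
        ext i j
        fin_cases i <;> fin_cases j <;> simp [Matrix.mul_apply]
      have h := isGood_of_plane hq hB p.1.1.2 (hnorm p.1.1.1 p.1.2) (hδ _)
      convert h using 1
      · rw [Matrix.fromRows_mul, Matrix.mul_assoc]
        congr 1
        · ext i j
          rw [Subsingleton.elim i j]
          simp [Matrix.mul_apply, planeVec]
        · ext i j
          simp [Matrix.mul_apply, planeVec]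
      · simp only
        rw [Matrix.fromRows_mul, Matrix.mul_assoc]
        congr 1
        · ext i j
          rw [Subsingleton.elim i 0, Subsingleton.elim j 0]
          simp [Matrix.mul_apply, planeVec]
        · ext i j
          rw [Subsingleton.elim j 0]
          simp [Matrix.mul_apply, planeVec, mul_comm]⟩
  refine Nat.card_le_card_of_injective f ?_
  rintro ⟨⟨c, a⟩, Y⟩ ⟨⟨c', a'⟩, Y'⟩ h
  have hr := (Matrix.fromRows_ext_iff _ _ _ _).1 (congrArg (fun W => W.1.1) h)
  have hc : c = c' := by
    apply Subtype.ext
    apply (algebraMap F A).injective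
    rw [← hnorm c.1 a, ← hnorm c'.1 a']
    have h0 : δ c.1 * a.1 0 0 = δ c'.1 * a'.1 0 0 := congrFun₂ hr.1 0 0
    rw [h0]
  subst hc
  have hd := isUnit_of_norm (hne c).1 (hδ c.1)
  have he := isUnit_of_norm (hne c).2 (hδ (1 - c.1))
  rw [hd.smul_left_cancel, he.smul_left_cancel] at hr
  obtain rfl : a = a' := Subtype.ext hr.1
  obtain rfl : Y = Y' := Subtype.ext hr.2
  rfl

end GoodCount

/-! ### From isometries to proportions of group elements -/

section GroupCount

variable {F A : Type*} [Field F] [Fintype F] [CommRing A] [StarRing A] [Algebra F A]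
  {r r' k : Type*} [Fintype r] [DecidableEq r] [Fintype r'] [DecidableEq r'] [Fintype k]
  [DecidableEq k]

theorem specialUnitary_isometry (g : Matrix.specialUnitaryGroup r A) : g.1ᴴ * g.1 = 1 := g.2.1.1

theorem specialUnitary_mul_conjTranspose (g : Matrix.specialUnitaryGroup r A) :
    g.1 * g.1ᴴ = 1 := g.2.1.2

/-- The special unitary group acts on isometries by composition. -/
def moveIsom (g : Matrix.specialUnitaryGroup r A) (P : Isom A r k) : Isom A r k :=
  ⟨g.1 * P.1, isometry_mul (specialUnitary_isometry g) P.2⟩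

theorem moveIsom_mul (g h : Matrix.specialUnitaryGroup r A) (P : Isom A r k) :
    moveIsom (g * h) P = moveIsom g (moveIsom h P) :=
  Subtype.ext (Matrix.mul_assoc _ _ _)

theorem moveIsom_one (P : Isom A r k) : moveIsom 1 P = P := Subtype.ext (Matrix.one_mul _)

theorem QuadraticStar.exists_moveIsom_eq [Nontrivial A] (hA : QuadraticStar F A)
    (hc : Fintype.card k < Fintype.card r) (P W : Isom A r k) :
    ∃ g : Matrix.specialUnitaryGroup r A, moveIsom g P = W := by
  obtain ⟨g, hg, h⟩ := hA.exists_specialUnitary_mul_eq P.2 W.2 hc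
  exact ⟨⟨g, hg⟩, Subtype.ext h⟩

/-- Orbit counting: the action is transitive, so g ↦ g P has fibres of constant size, that of the
stabiliser of P. -/
theorem QuadraticStar.card_specialUnitary_mul [Nontrivial A] (hA : QuadraticStar F A)
    (hc : Fintype.card k < Fintype.card r) (P : Isom A r k) (p : Isom A r k → Prop) :
    Nat.card {g : Matrix.specialUnitaryGroup r A // p (moveIsom g P)} * Nat.card (Isom A r k) =
      Nat.card (Matrix.specialUnitaryGroup r A) * Nat.card {W : Isom A r k // p W} := by
  choose h hh using hA.exists_moveIsom_eq hc P
  have key : ∀ p : Isom A r k → Prop,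
      Nat.card {g : Matrix.specialUnitaryGroup r A // p (moveIsom g P)} =
        Nat.card {W : Isom A r k // p W} *
          Nat.card {g : Matrix.specialUnitaryGroup r A // moveIsom g P = P} := by
    intro p
    rw [← Nat.card_prod]
    refine Nat.card_congr
      { toFun := fun g => (⟨moveIsom g.1 P, g.2⟩, ⟨(h (moveIsom g.1 P))⁻¹ * g.1, ?_⟩)
        invFun := fun x => ⟨h x.1.1 * x.2.1, ?_⟩
        left_inv := ?_
        right_inv := ?_ }
    · rw [moveIsom_mul]
      conv_lhs => rw [← hh (moveIsom g.1 P), ← moveIsom_mul]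
      rw [hh, inv_mul_cancel, moveIsom_one]
    · rw [moveIsom_mul, x.2.2, hh]
      exact x.1.2
    · intro g
      simp
    · rintro ⟨⟨W, hW⟩, ⟨g, hg⟩⟩
      have : moveIsom (h W * g) P = W := by rw [moveIsom_mul, hg, hh]
      simp [this]
  have h1 := key fun _ => True
  rw [Nat.card_congr (Equiv.subtypeUnivEquiv fun _ => trivial),
    Nat.card_congr (Equiv.subtypeUnivEquiv fun _ => trivial)] at h1
  rw [key p, h1]
  ring

theorem fromRows_one_zero_isometry {l m : Type*} [Fintype l] [Fintype m] [DecidableEq l]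
    [DecidableEq m] :
    (Matrix.fromRows 1 0 : Matrix (l ⊕ m) l A)ᴴ * (Matrix.fromRows 1 0 : Matrix (l ⊕ m) l A) = 1 := by
  rw [Matrix.conjTranspose_fromRows_eq_fromCols_conjTranspose, Matrix.fromCols_mul_fromRows]
  simp

theorem submatrix_isometry (e : r' ≃ r) {W : Matrix r k A} (hW : Wᴴ * W = 1) :
    (W.submatrix e id)ᴴ * W.submatrix e id = 1 := by
  rw [Matrix.conjTranspose_submatrix, Matrix.submatrix_mul_equiv, hW, Matrix.submatrix_id_id]

theorem card_good_submatrix [Finite A] (e : r' ≃ r) (P : Matrix r k A) :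
    Nat.card {W : Isom A r k // IsGood P W.1} ≤
      Nat.card {W : Isom A r' k // IsGood (P.submatrix e id) W.1} := by
  refine Nat.card_le_card_of_injective
    (fun W => ⟨⟨W.1.1.submatrix e id, submatrix_isometry e W.1.2⟩, W.2.submatrix e⟩) ?_
  intro W W' h
  have h1 : W.1.1.submatrix e id = W'.1.1.submatrix e id := congrArg (fun X => X.1.1) h
  apply Subtype.ext
  apply Subtype.ext
  have h2 := congrArg (fun M => M.submatrix e.symm id) h1
  simpa using h2

theorem inflate_complement {l m : Type*} [Fintype l] [DecidableEq l] [Fintype m] [DecidableEq m]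
    {P : Matrix r l A} {v : Matrix r m A} (h : P * Pᴴ + v * vᴴ = 1) :
    inflate P (-1) = - inflate v (-1) := by
  rw [inflate_neg_one, inflate_neg_one, eq_sub_of_add_eq h, smul_sub, two_smul]
  abel

/-- The rank is t + 4. Here `C` counts parameters of one kind, `a`, `b`, `c`, `x` and `y` count unit
vectors of ranks 2, t + 2, t + 1, t + 4 and t + 3, `G` counts good isometries, and `S`, `S'` count
all and good group elements. The powers of q involving t agree on both sides, which leaves one
inequality in q. -/
theorem fraction_bound_of_four_le (t : ℕ) {q C a b c x y G S S' : ℝ} (hq : 5 ≤ q)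
    (hC : q ≤ 3 + 4 * C) (ha : q ^ 2 * (q - 1) ≤ a) (hb : q ^ (2 * (t + 1)) * (q - 1) ≤ b)
    (hc : q ^ (2 * t) * (q - 1) ≤ c) (hx : x ≤ q ^ (2 * (t + 3)) * (q + 1))
    (hy : y ≤ q ^ (2 * (t + 2)) * (q + 1)) (hx0 : 0 < x) (hy0 : 0 < y)
    (hG : C * C * a ^ 2 * (b * c) ≤ G) (hS : 0 ≤ S) (h : S' * (x * y) = S * G) :
    1 / 750 * (1 - 2 / q) * S ≤ S' := by
  have hq0 : 0 < q := by linarith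
  have hd : 0 ≤ 1 - 2 / q := by
    rw [sub_nonneg, div_le_one hq0]
    linarith
  have poly : 1 / 750 * (1 - 2 / q) * (q ^ 10 * (q + 1) ^ 2) ≤
      ((q - 3) / 4) * ((q - 3) / 4) * (q ^ 2 * (q - 1)) ^ 2 * (q ^ 2 * (q - 1) * (q - 1)) := by
    have h1 : 1 / 750 * (1 - 2 / q) * (q ^ 10 * (q + 1) ^ 2) =
        1 / 750 * (q - 2) * (q ^ 9 * (q + 1) ^ 2) := by
      field_simp
    rw [h1]
    -- After q = 5 + z the difference is a polynomial in z with nonnegative coefficients.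
    obtain ⟨z, rfl⟩ : ∃ z, q = 5 + z := ⟨q - 5, by ring⟩
    have hz : 0 ≤ z := by linarith
    rw [← sub_nonneg]
    ring_nf
    positivity
  have key : 1 / 750 * (1 - 2 / q) * (x * y) ≤ G := by
    refine le_trans ?_ hG
    have hQ : 0 < q ^ (2 * t) := by positivity
    calc 1 / 750 * (1 - 2 / q) * (x * y)
        ≤ 1 / 750 * (1 - 2 / q) * ((q ^ (2 * (t + 3)) * (q + 1)) *
            (q ^ (2 * (t + 2)) * (q + 1))) := by gcongr
      _ = (1 / 750 * (1 - 2 / q) * (q ^ 10 * (q + 1) ^ 2)) * (q ^ (2 * t)) ^ 2 := by ring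
      _ ≤ (((q - 3) / 4) * ((q - 3) / 4) * (q ^ 2 * (q - 1)) ^ 2 * (q ^ 2 * (q - 1) * (q - 1))) *
            (q ^ (2 * t)) ^ 2 := by gcongr
      _ = ((q - 3) / 4) * ((q - 3) / 4) * (q ^ 2 * (q - 1)) ^ 2 *
            ((q ^ (2 * (t + 1)) * (q - 1)) * (q ^ (2 * t) * (q - 1))) := by ring
      _ ≤ C * C * a ^ 2 * (b * c) := by
          have h1 : 0 ≤ q - 1 := by linarith
          have h3 : 0 ≤ (q - 3) / 4 := by linarith
          have h4 : (q - 3) / 4 ≤ C := by linarith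
          have hC0 : 0 ≤ C := h3.trans h4
          have ha0 : 0 ≤ a := le_trans (by positivity) ha
          have hb0 : 0 ≤ b := le_trans (by positivity) hb
          gcongr
  have hxy : 0 < x * y := mul_pos hx0 hy0
  refine le_of_mul_le_mul_right ?_ hxy
  rw [h]
  nlinarith [mul_le_mul_of_nonneg_left key hS]

theorem fraction_bound_of_three {q C a b x G S S' : ℝ} (hq : 5 ≤ q)
    (hC : q ≤ 3 + 4 * C) (ha : q - 1 ≤ a) (hb : q ^ 2 * (q - 1) ≤ b)
    (hx : x ≤ q ^ 4 * (q + 1)) (hx0 : 0 < x)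
    (hG : C * a * b ≤ G) (hS : 0 ≤ S) (h : S' * x = S * G) :
    1 / 750 * (1 - 2 / q) * S ≤ S' := by
  have hq0 : 0 < q := by linarith
  have hd : 0 ≤ 1 - 2 / q := by
    rw [sub_nonneg, div_le_one hq0]
    linarith
  have poly : 1 / 750 * (1 - 2 / q) * (q ^ 4 * (q + 1)) ≤
      ((q - 3) / 4) * (q - 1) * (q ^ 2 * (q - 1)) := by
    have h1 : 1 / 750 * (1 - 2 / q) * (q ^ 4 * (q + 1)) =
        1 / 750 * (q - 2) * (q ^ 3 * (q + 1)) := by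
      field_simp
    rw [h1]
    obtain ⟨z, rfl⟩ : ∃ z, q = 5 + z := ⟨q - 5, by ring⟩
    have hz : 0 ≤ z := by linarith
    rw [← sub_nonneg]
    ring_nf
    positivity
  have key : 1 / 750 * (1 - 2 / q) * x ≤ G := by
    refine le_trans ?_ hG
    calc 1 / 750 * (1 - 2 / q) * x
        ≤ 1 / 750 * (1 - 2 / q) * (q ^ 4 * (q + 1)) := by gcongr
      _ ≤ ((q - 3) / 4) * (q - 1) * (q ^ 2 * (q - 1)) := poly
      _ ≤ C * a * b := by
          have h1 : 0 ≤ q - 1 := by linarith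
          have h3 : 0 ≤ (q - 3) / 4 := by linarith
          have h4 : (q - 3) / 4 ≤ C := by linarith
          have hC0 : 0 ≤ C := h3.trans h4
          have ha0 : 0 ≤ a := h1.trans ha
          gcongr
  refine le_of_mul_le_mul_right ?_ hx0
  rw [h]
  nlinarith [mul_le_mul_of_nonneg_left key hS]

theorem QuadraticStar.card_unit_pos (hA : QuadraticStar F A) (m : ℕ)
    (hq : 3 < Fintype.card F) : 0 < Nat.card (Isom A (Fin (m + 1)) (Fin 1)) :=
  lt_of_lt_of_le (Nat.mul_pos (by positivity) (by omega)) (hA.card_unit_lower m)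

theorem five_le_of_odd {q : ℕ} (hodd : Odd q) (hq : 3 < q) : (5 : ℝ) ≤ q := by
  have : 5 ≤ q := by
    obtain ⟨j, hj⟩ := hodd
    omega
  exact_mod_cast this

theorem QuadraticStar.exists_good_fraction_of_four_le [Nontrivial A] [Finite A]
    (hA : QuadraticStar F A) (hodd : Odd (Fintype.card F)) (hq : 3 < Fintype.card F)
    (hn : 4 ≤ Fintype.card r) :
    ∃ P : Isom A r (Fin 2), 1 / 750 * (1 - 2 / (Fintype.card F : ℝ)) *
      Nat.card (Matrix.specialUnitaryGroup r A) ≤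
      Nat.card {g : Matrix.specialUnitaryGroup r A // IsGood P.1 (moveIsom g P).1} := by
  obtain ⟨t, ht⟩ := Nat.exists_eq_add_of_le hn
  have e : r ≃ Fin 2 ⊕ Fin (t + 2) := Fintype.equivOfCardEq (by simp; omega)
  have e' : r ≃ Fin (t + 3 + 1) := Fintype.equivOfCardEq (by simp; omega)
  let P : Isom A r (Fin 2) := ⟨_, submatrix_isometry e fromRows_one_zero_isometry⟩
  refine ⟨P, ?_⟩
  have h1 := hA.card_specialUnitary_mul (by simp; omega) P fun W => IsGood P.1 W.1
  have h2 := (card_good_planes (κ := Fin (t + 2)) hA hodd).trans (card_good_submatrix e _)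
  rw [card_nonsqSq, card_isom_two hA (t + 1)] at h2
  rw [card_isom_congr e' (Equiv.refl _), card_isom_two hA (t + 3)] at h1
  have hsub : ((Fintype.card F - 1 : ℕ) : ℝ) = Fintype.card F - 1 := by
    rw [Nat.cast_sub (by omega), Nat.cast_one]
  refine fraction_bound_of_four_le t (C := Nat.card (SqNonsq F))
    (G := Nat.card {W : Isom A r (Fin 2) // IsGood P.1 W.1}) (five_le_of_odd hodd hq)
    (by exact_mod_cast card_le_card_sqNonsq hodd)
    (a := Nat.card (Isom A (Fin 2) (Fin 1)))
    (b := Nat.card (Isom A (Fin (t + 1 + 1)) (Fin 1)))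
    (c := Nat.card (Isom A (Fin (t + 1)) (Fin 1)))
    (x := Nat.card (Isom A (Fin (t + 3 + 1)) (Fin 1)))
    (y := Nat.card (Isom A (Fin (t + 3)) (Fin 1))) ?_ ?_ ?_ ?_ ?_ ?_ ?_
    (by exact_mod_cast h2) (Nat.cast_nonneg _) (by exact_mod_cast h1)
  · rw [← hsub]
    exact_mod_cast hA.card_unit_lower 1
  · rw [← hsub]
    exact_mod_cast hA.card_unit_lower (t + 1)
  · rw [← hsub]
    exact_mod_cast hA.card_unit_lower t
  · exact_mod_cast hA.card_unit_upper (t + 3)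
  · exact_mod_cast hA.card_unit_upper (t + 2)
  · exact_mod_cast hA.card_unit_pos (t + 3) hq
  · exact_mod_cast hA.card_unit_pos (t + 2) hq

/-- Let `v` span the complement of the plane `P`. The involution of `P` is minus the reflection in
`v`, and the signs cancel in the product of two conjugates, so lines can replace planes. -/
theorem QuadraticStar.exists_good_fraction_of_three [Nontrivial A] [Finite A]
    (hA : QuadraticStar F A) (hodd : Odd (Fintype.card F)) (hq : 3 < Fintype.card F)
    (hn : Fintype.card r = 3) :
    ∃ P : Isom A r (Fin 2), 1 / 750 * (1 - 2 / (Fintype.card F : ℝ)) *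
      Nat.card (Matrix.specialUnitaryGroup r A) ≤
      Nat.card {g : Matrix.specialUnitaryGroup r A // IsGood P.1 (moveIsom g P).1} := by
  have e : r ≃ Fin 1 ⊕ Fin 2 := Fintype.equivOfCardEq (by simp; omega)
  have e' : r ≃ Fin (2 + 1) := Fintype.equivOfCardEq (by simp; omega)
  let v : Isom A r (Fin 1) := ⟨_, submatrix_isometry e fromRows_one_zero_isometry⟩
  let P : Isom A r (Fin 2) := ⟨(Matrix.fromRows 0 1).submatrix e id, submatrix_isometry e (by
    rw [Matrix.conjTranspose_fromRows_eq_fromCols_conjTranspose, Matrix.fromCols_mul_fromRows]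
    simp)⟩
  have hPv : P.1 * P.1ᴴ + v.1 * v.1ᴴ = 1 := by
    have hadd : ∀ X Y : Matrix (Fin 1 ⊕ Fin 2) (Fin 1 ⊕ Fin 2) A,
        X.submatrix e e + Y.submatrix e e = (X + Y).submatrix e e := fun _ _ => rfl
    simp only [P, v]
    rw [Matrix.conjTranspose_submatrix, Matrix.conjTranspose_submatrix,
      ← Matrix.submatrix_mul _ _ e id e Function.bijective_id,
      ← Matrix.submatrix_mul _ _ e id e Function.bijective_id,
      hadd, Matrix.conjTranspose_fromRows_eq_fromCols_conjTranspose,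
      Matrix.conjTranspose_fromRows_eq_fromCols_conjTranspose, Matrix.fromRows_mul_fromCols,
      Matrix.fromRows_mul_fromCols, Matrix.fromBlocks_add]
    simp
  have hgood : ∀ g : Matrix.specialUnitaryGroup r A, IsGood v.1 (moveIsom g v).1 →
      IsGood P.1 (moveIsom g P).1 := by
    rintro g ⟨m, Z, hZ, h⟩
    refine ⟨m, Z, hZ, ?_⟩
    have hgg := specialUnitary_mul_conjTranspose g
    rw [← h]
    simp only [moveIsom]
    rw [← conj_inflate hgg, ← conj_inflate hgg, inflate_complement hPv]
    simp
  refine ⟨P, le_trans ?_ (Nat.cast_le.2 (Nat.card_le_card_of_injective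
    (fun g : {g : Matrix.specialUnitaryGroup r A // IsGood v.1 (moveIsom g v).1} =>
      (⟨g.1, hgood g.1 g.2⟩ : {g : Matrix.specialUnitaryGroup r A //
        IsGood P.1 (moveIsom g P).1})) fun g g' h => Subtype.ext (congrArg (fun x => x.1) h)))⟩
  have h1 := hA.card_specialUnitary_mul (by simp; omega) v fun W => IsGood v.1 W.1
  have h2 := (card_good_lines (κ := Fin 2) hA hodd).trans (card_good_submatrix e _)
  rw [card_nonsqSq] at h2
  rw [card_isom_congr e' (Equiv.refl _)] at h1
  have hsub : ((Fintype.card F - 1 : ℕ) : ℝ) = Fintype.card F - 1 := by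
    rw [Nat.cast_sub (by omega), Nat.cast_one]
  refine fraction_bound_of_three (C := Nat.card (SqNonsq F))
    (G := Nat.card {W : Isom A r (Fin 1) // IsGood v.1 W.1}) (five_le_of_odd hodd hq)
    (by exact_mod_cast card_le_card_sqNonsq hodd)
    (a := Nat.card (Isom A (Fin 1) (Fin 1)))
    (b := Nat.card (Isom A (Fin 2) (Fin 1)))
    (x := Nat.card (Isom A (Fin (2 + 1)) (Fin 1))) ?_ ?_ ?_ ?_
    (by exact_mod_cast h2) (Nat.cast_nonneg _) (by exact_mod_cast h1)
  · rw [← hsub]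
    simpa using (Nat.cast_le (α := ℝ)).2 (hA.card_unit_lower 0)
  · rw [← hsub]
    exact_mod_cast hA.card_unit_lower 1
  · exact_mod_cast hA.card_unit_upper 2
  · exact_mod_cast hA.card_unit_pos 2 hq

instance [Finite A] : Finite (Matrix.specialUnitaryGroup r A) := by
  have : Finite (Matrix r r A) := inferInstanceAs (Finite (r → r → A))
  infer_instance

/-- The fraction of `g` such that a power of the product of the involution of a nondegenerate plane
and its conjugate by `g` is again the involution of a nondegenerate plane. -/
theorem QuadraticStar.good_fraction [Nontrivial A] [Finite A]
    (hA : QuadraticStar F A) (hodd : Odd (Fintype.card F)) (hq : 3 < Fintype.card F)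
    (hn : 3 ≤ Fintype.card r) (P : Isom A r (Fin 2)) :
    1 / 750 * (1 - 2 / (Fintype.card F : ℝ)) * Nat.card (Matrix.specialUnitaryGroup r A) ≤
      Nat.card {g : Matrix.specialUnitaryGroup r A // IsGood P.1 (moveIsom g P).1} := by
  have hex : ∃ P : Isom A r (Fin 2), 1 / 750 * (1 - 2 / (Fintype.card F : ℝ)) *
      Nat.card (Matrix.specialUnitaryGroup r A) ≤
      Nat.card {g : Matrix.specialUnitaryGroup r A // IsGood P.1 (moveIsom g P).1} := by
    rcases hn.eq_or_lt with h | h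
    · exact hA.exists_good_fraction_of_three hodd hq h.symm
    · exact hA.exists_good_fraction_of_four_le hodd hq h
  obtain ⟨P₀, h₀⟩ := hex
  -- The estimate is known for one plane. Conjugation by an element moving that plane to `P` carries
  -- good elements to good elements.
  obtain ⟨x, hx⟩ := hA.exists_moveIsom_eq (by simp; omega) P₀ P
  refine h₀.trans (Nat.cast_le.2 (Nat.card_le_card_of_injective
    (fun g : {g : Matrix.specialUnitaryGroup r A // IsGood P₀.1 (moveIsom g P₀).1} =>
      (⟨x * g.1 * x⁻¹, ?_⟩ : {g : Matrix.specialUnitaryGroup r A //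
        IsGood P.1 (moveIsom g P).1})) ?_))
  · have h := g.2.mul_left (specialUnitary_isometry x)
    have h1 : moveIsom (x * g.1 * x⁻¹) P = moveIsom x (moveIsom g.1 P₀) := by
      rw [← hx, ← moveIsom_mul, inv_mul_cancel_right, moveIsom_mul]
    rw [h1, ← hx]
    exact h
  · intro g g' h
    have h1 : x * g.1 * x⁻¹ = x * g'.1 * x⁻¹ := congrArg Subtype.val h
    exact Subtype.ext (mul_left_cancel (mul_right_cancel h1))

end GroupCount

/-! ### Counting unit vectors -/

section UnitVectors

variable {F A : Type*} [Field F] [Fintype F] [CommRing A] [StarRing A] [Algebra F A]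

theorem card_isom_one (m : ℕ) : Nat.card {v : Matrix (Fin m) (Fin 1) A // vᴴ * v = 1} =
    Nat.card {v : Fin m → A // ∑ i, star (v i) * v i = 1} := by
  refine Nat.card_congr
    { toFun := fun v => ⟨fun i => v.1 i 0, by
        simpa [Matrix.mul_apply] using congrFun₂ v.2 0 0⟩
      invFun := fun v => ⟨Matrix.of fun i _ => v.1 i, by
        ext i j
        rw [Subsingleton.elim i j]
        simpa [Matrix.mul_apply] using v.2⟩
      left_inv := fun v => by
        apply Subtype.ext
        ext i j
        rw [Subsingleton.elim j 0]
        rfl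
      right_inv := fun v => rfl }

/-- Once all coordinates but the first are chosen, the norm of the first is prescribed. It is 0
exactly when the others already form a unit vector, which separates ν₀ from ν₁. -/
theorem card_unit_succ [Fintype A] (hfix : ∀ a : A, star a = a → ∃ c : F, algebraMap F A c = a)
    {ν₀ ν₁ : ℕ}
    (h₀ : Nat.card {a : A // star a * a = 0} = ν₀)
    (h₁ : ∀ c : F, c ≠ 0 → Nat.card {a : A // star a * a = algebraMap F A c} = ν₁) (m : ℕ) :
    (Nat.card {v : Fin (m + 1) → A // ∑ i, star (v i) * v i = 1} : ℤ) =
      ν₁ * Nat.card A ^ m +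
        (ν₀ - ν₁) * Nat.card {v : Fin m → A // ∑ i, star (v i) * v i = 1} := by
  classical
  have e : {v : Fin (m + 1) → A // ∑ i, star (v i) * v i = 1} ≃
      Σ w : Fin m → A, {a : A // star a * a = 1 - ∑ i, star (w i) * w i} :=
    (((Fin.consEquiv fun _ : Fin (m + 1) => A).symm.trans (Equiv.prodComm _ _)).subtypeEquiv
      (q := fun p => star p.2 * p.2 = 1 - ∑ i, star (p.1 i) * p.1 i) (fun v => by
        rw [eq_sub_iff_add_eq, Fin.sum_univ_succ]
        rfl)).trans
      (Equiv.subtypeProdEquivSigmaSubtype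
        fun (w : Fin m → A) (a : A) => star a * a = 1 - ∑ i, star (w i) * w i)
  rw [Nat.card_congr e, Nat.card_sigma]
  have hterm : ∀ w : Fin m → A,
      (Nat.card {a : A // star a * a = 1 - ∑ i, star (w i) * w i} : ℤ) =
        ν₁ + (ν₀ - ν₁) * if ∑ i, star (w i) * w i = 1 then 1 else 0 := by
    intro w
    split_ifs with h
    · simp only [h, sub_self, h₀]
      ring
    · obtain ⟨c, hc⟩ := hfix (1 - ∑ i, star (w i) * w i) (by
        simp [star_sub, star_sum, star_mul])
      have hc0 : c ≠ 0 := by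
        rintro rfl
        rw [map_zero] at hc
        exact h (sub_eq_zero.1 hc.symm).symm
      rw [← hc, h₁ c hc0]
      ring
  rw [Nat.cast_sum, Finset.sum_congr rfl fun w _ => hterm w, Finset.sum_add_distrib,
    ← Finset.mul_sum, Finset.sum_boole]
  simp only [Finset.sum_const, Finset.card_univ, nsmul_eq_mul, Fintype.card_fun, Fintype.card_fin,
    Nat.card_eq_fintype_card, Nat.cast_pow, Fintype.card_subtype]
  ring

/-- The sign ε is 1 for `F × F` and -1 for the quadratic extension. The recursion solves to q^(2m+1)
- ε^(m+1) q^m unit vectors of rank m + 1, and q^m is at most q^(2m). -/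
theorem card_unit_bounds [Finite A] (hfix : ∀ a : A, star a = a → ∃ c : F, algebraMap F A c = a)
    {ε : ℤ} (hε : ε = 1 ∨ ε = -1) {ν₀ ν₁ : ℕ} (hA : Nat.card A = Fintype.card F ^ 2)
    (h₀ : Nat.card {a : A // star a * a = 0} = ν₀)
    (h₁ : ∀ c : F, c ≠ 0 → Nat.card {a : A // star a * a = algebraMap F A c} = ν₁)
    (hν₁ : (ν₁ : ℤ) = Fintype.card F - ε) (hν₀ : (ν₀ : ℤ) - ν₁ = ε * Fintype.card F) (m : ℕ) :
    Fintype.card F ^ (2 * m) * (Fintype.card F - 1) ≤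
      Nat.card {v : Matrix (Fin (m + 1)) (Fin 1) A // vᴴ * v = 1} ∧
    Nat.card {v : Matrix (Fin (m + 1)) (Fin 1) A // vᴴ * v = 1} ≤
      Fintype.card F ^ (2 * m) * (Fintype.card F + 1) := by
  have := Fintype.ofFinite A
  have hpos : 0 < Fintype.card F := Fintype.card_pos
  set q := Fintype.card F with hq
  -- The count is multiplied by q so that the closed form also covers m = 0, where there is no unit
  -- vector.
  have formula : ∀ m : ℕ, (q : ℤ) * Nat.card {v : Fin m → A // ∑ i, star (v i) * v i = 1} =
      (q : ℤ) ^ (2 * m) - (ε * q) ^ m := by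
    intro m
    induction m with
    | zero =>
      have hnt : Nontrivial A := by
        rw [← Finite.one_lt_card_iff_nontrivial, hA]
        exact Nat.one_lt_pow (by norm_num) Fintype.one_lt_card
      simp
    | succ m ih =>
      rw [card_unit_succ hfix h₀ h₁, hν₀, hν₁, hA]
      push_cast
      linear_combination (ε * q) * ih
  have h := formula (m + 1)
  rw [← card_isom_one] at h
  have hq1 : (1 : ℤ) ≤ q := by exact_mod_cast hpos
  have hε2 : |ε ^ (m + 1)| = 1 := by
    rw [abs_pow]
    rcases hε with rfl | rfl <;> simp
  have hN : (Nat.card {v : Matrix (Fin (m + 1)) (Fin 1) A // vᴴ * v = 1} : ℤ) =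
      (q : ℤ) ^ (2 * m + 1) - ε ^ (m + 1) * q ^ m := by
    apply mul_left_cancel₀ (show (q : ℤ) ≠ 0 by omega)
    rw [h]
    ring
  have hpow : (q : ℤ) ^ m ≤ (q : ℤ) ^ (2 * m) := pow_le_pow_right₀ hq1 (by omega)
  have hp0 : (0 : ℤ) ≤ (q : ℤ) ^ m := by positivity
  obtain ⟨l, u⟩ := abs_le.1 hε2.le
  have hsplit : (q : ℤ) ^ (2 * m + 1) = q ^ (2 * m) * q := pow_succ _ _
  have hsub : ((q - 1 : ℕ) : ℤ) = q - 1 := by omega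
  constructor
  · rw [← Nat.cast_le (α := ℤ)]
    push_cast [hsub]
    rw [hN]
    nlinarith
  · rw [← Nat.cast_le (α := ℤ)]
    push_cast
    rw [hN]
    nlinarith

end UnitVectors

/-! ### The split case: `F × F` with the swap -/

section Split

variable (F : Type*) [Field F]

/-- The ring `F × F`, to be endowed with the involution that swaps the factors. -/
def SplitDouble : Type _ := F × F

instance : CommRing (SplitDouble F) := inferInstanceAs (CommRing (F × F))

instance : Algebra F (SplitDouble F) := inferInstanceAs (Algebra F (F × F))

instance : Nontrivial (SplitDouble F) := inferInstanceAs (Nontrivial (F × F))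

instance [Finite F] : Finite (SplitDouble F) := inferInstanceAs (Finite (F × F))

instance : StarRing (SplitDouble F) where
  star x := (x.2, x.1)
  star_involutive _ := rfl
  star_mul _ _ := Prod.ext (mul_comm _ _) (mul_comm _ _)
  star_add _ _ := rfl

variable {F}

theorem SplitDouble.star_mul_self_eq_iff (a : SplitDouble F) (c : F) :
    star a * a = algebraMap F (SplitDouble F) c ↔ a.1 * a.2 = c := by
  constructor
  · intro h
    exact congrArg Prod.snd h
  · intro h
    exact Prod.ext ((mul_comm _ _).trans h) h

theorem SplitDouble.star_mul_self_eq_zero_iff (a : SplitDouble F) :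
    star a * a = 0 ↔ a.1 * a.2 = 0 := by
  rw [← map_zero (algebraMap F (SplitDouble F)), SplitDouble.star_mul_self_eq_iff]

theorem SplitDouble.card_norm_eq [Fintype F] {c : F} (hc : c ≠ 0) :
    Nat.card {a : SplitDouble F // star a * a = algebraMap F (SplitDouble F) c} =
      Fintype.card F - 1 := by
  rw [← Nat.card_eq_fintype_card, ← Nat.card_units]
  refine Nat.card_congr
    { toFun := fun a => Units.mk0 a.1.1 fun h => hc (by
        rw [← (SplitDouble.star_mul_self_eq_iff a.1 c).1 a.2, h, zero_mul])
      invFun := fun u => ⟨((u : F), (u : F)⁻¹ * c),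
        (SplitDouble.star_mul_self_eq_iff _ c).2 (by simp)⟩
      left_inv := fun a => by
        have h := (SplitDouble.star_mul_self_eq_iff a.1 c).1 a.2
        apply Subtype.ext
        refine Prod.ext rfl ?_
        have h0 : a.1.1 ≠ 0 := fun h0 => hc (by rw [← h, h0, zero_mul])
        simp [← h, h0]
      right_inv := fun u => by
        ext
        rfl }

theorem SplitDouble.card_norm_zero [Fintype F] :
    Nat.card {a : SplitDouble F // star a * a = 0} = 2 * Fintype.card F - 1 := by
  have h1 : Nat.card {a : SplitDouble F // star a * a = 0} + (Fintype.card F - 1) *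
      (Fintype.card F - 1) = Fintype.card F * Fintype.card F := by
    have e : {a : SplitDouble F // ¬ star a * a = 0} ≃ Fˣ × Fˣ :=
      { toFun := fun a =>
          have h : a.1.1 * a.1.2 ≠ 0 := fun h => a.2 ((star_mul_self_eq_zero_iff a.1).2 h)
          (Units.mk0 a.1.1 (left_ne_zero_of_mul h), Units.mk0 a.1.2 (right_ne_zero_of_mul h))
        invFun := fun u => ⟨((u.1 : F), (u.2 : F)), fun h =>
          mul_ne_zero u.1.ne_zero u.2.ne_zero ((star_mul_self_eq_zero_iff _).1 h)⟩
        left_inv := fun a => rfl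
        right_inv := fun u => Prod.ext (Units.ext rfl) (Units.ext rfl) }
    classical
    have h2 : Nat.card {a : SplitDouble F // ¬ star a * a = 0} =
        (Fintype.card F - 1) * (Fintype.card F - 1) := by
      rw [Nat.card_congr e, Nat.card_prod, Nat.card_units, Nat.card_eq_fintype_card]
    rw [← h2, ← Nat.card_sum, Nat.card_congr (Equiv.sumCompl _)]
    exact (Nat.card_prod F F).trans (by rw [Nat.card_eq_fintype_card])
  have hpos : 0 < Fintype.card F := Fintype.card_pos
  obtain ⟨j, hj⟩ : ∃ j, Fintype.card F = j + 1 := ⟨Fintype.card F - 1, by omega⟩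
  rw [hj] at h1 ⊢
  simp only [Nat.add_sub_cancel] at h1
  have h3 : (j + 1) * (j + 1) = j * j + (2 * (j + 1) - 1) := by
    have : 2 * (j + 1) - 1 = 2 * j + 1 := by omega
    rw [this]; ring
  omega

theorem SplitDouble.exists_of_star_eq (a : SplitDouble F) (h : star a = a) :
    ∃ c : F, algebraMap F (SplitDouble F) c = a := by
  have h1 : a.1 = a.2 := congrArg Prod.snd h
  exact ⟨a.1, Prod.ext rfl h1⟩

theorem quadraticStar_split [Fintype F] : QuadraticStar F (SplitDouble F) := by
  have hb := card_unit_bounds (F := F) (A := SplitDouble F) SplitDouble.exists_of_star_eq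
    (ε := 1) (Or.inl rfl) ((Nat.card_prod F F).trans (by rw [Nat.card_eq_fintype_card, pow_two]))
    SplitDouble.card_norm_zero (fun c hc => SplitDouble.card_norm_eq hc)
    (by have : 0 < Fintype.card F := Fintype.card_pos
        omega)
    (by have : 0 < Fintype.card F := Fintype.card_pos
        omega)
  refine ⟨fun c => rfl, SplitDouble.exists_of_star_eq, ?_, ?_, fun m => (hb m).1,
    fun m => (hb m).2⟩
  · intro c _
    exact ⟨(c, 1), (SplitDouble.star_mul_self_eq_iff _ c).2 (mul_one c)⟩
  · intro a h
    have h1 := congrArg Prod.fst (h (1, 0))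
    have h2 := congrArg Prod.fst (h (0, 1))
    change 1 * a.1 + 0 * a.2 = 0 at h1
    change 0 * a.1 + 1 * a.2 = 0 at h2
    rw [one_mul, zero_mul, add_zero] at h1
    rw [one_mul, zero_mul, zero_add] at h2
    exact Prod.ext h1 h2

end Split

/-! ### The field case: a quadratic extension with Frobenius -/

section Frobenius

variable (F E : Type*) [Field F] [Fintype F] [Field E] [Algebra F E]

theorem pow_card_card (hE : Module.finrank F E = 2) (x : E) :
    (x ^ Fintype.card F) ^ Fintype.card F = x := by
  have : Module.Finite F E := Module.finite_of_finrank_pos (by omega)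
  have : Finite E := Module.finite_of_finite F
  have := Fintype.ofFinite E
  have h := FiniteField.pow_card x
  rw [Module.card_eq_pow_finrank (K := F), hE, pow_two, pow_mul] at h
  exact h

/-- The involution `x ↦ x ^ q` of a quadratic extension of the field with `q` elements. -/
abbrev frobeniusStarRing (hE : Module.finrank F E = 2) : StarRing E where
  star x := FiniteField.frobeniusAlgHom F E x
  star_involutive x := pow_card_card F E hE x
  star_mul x y := by rw [map_mul, mul_comm]
  star_add x y := map_add _ x y

variable {F E}

/-- Here `star x * x` is the field norm. It is surjective, so its kernel on units has (q² - 1)/(q -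
1) = q + 1 elements and the fibres over nonzero elements are cosets of it. Galois theory identifies
the star-fixed elements with `F`. Testing the trace form of a nonzero a against its inverse gives 2,
which is nonzero in odd characteristic. -/
theorem quadraticStar_frobenius (hE : Module.finrank F E = 2) (hodd : Odd (Fintype.card F)) :
    letI := frobeniusStarRing F E hE
    QuadraticStar F E := by
  let := frobeniusStarRing F E hE
  have : Module.Finite F E := Module.finite_of_finrank_pos (by omega)
  have : Finite E := Module.finite_of_finite F
  have hpos : 1 < Fintype.card F := Fintype.one_lt_card
  have hcard : Nat.card E = Fintype.card F ^ 2 := by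
    rw [Module.natCard_eq_pow_finrank (K := F), hE, Nat.card_eq_fintype_card]
  have hstar : ∀ x : E, star x = x ^ Fintype.card F := fun x => rfl
  have hnorm : ∀ x : E, star x * x = algebraMap F E (Algebra.norm F x) := by
    intro x
    rw [FiniteField.algebraMap_norm_eq_pow, hstar, ← pow_succ, hcard, Nat.card_eq_fintype_card]
    congr 1
    symm
    apply Nat.div_eq_of_eq_mul_left (by omega)
    obtain ⟨j, hj⟩ : ∃ j, Fintype.card F = j + 1 := ⟨Fintype.card F - 1, by omega⟩
    rw [hj, Nat.add_sub_cancel]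
    have : (j + 1) ^ 2 = (j + 1 + 1) * j + 1 := by ring
    omega
  have hfix : ∀ a : E, star a = a → ∃ c : F, algebraMap F E c = a := by
    intro a ha
    have hmem : a ∈ (⊥ : IntermediateField F E) := by
      rw [IsGalois.mem_bot_iff_fixed]
      intro f
      obtain ⟨n, rfl⟩ := (FiniteField.bijective_frobeniusAlgEquivOfAlgebraic_pow F E).2 f
      have : ∀ n : ℕ, (FiniteField.frobeniusAlgEquivOfAlgebraic F E ^ n) a = a := by
        intro n
        induction n with
        | zero => rfl
        | succ n ih =>
          rw [pow_succ, AlgEquiv.mul_apply]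
          have h1 : FiniteField.frobeniusAlgEquivOfAlgebraic F E a = a := ha
          rw [h1, ih]
      exact this n
    exact IntermediateField.mem_bot.1 hmem
  have hker : Nat.card {a : E // star a * a = 1} = Fintype.card F + 1 := by
    let f : Eˣ →* Fˣ := Units.map (Algebra.norm F)
    have e : {a : E // star a * a = 1} ≃ f.ker :=
      { toFun := fun a => ⟨Units.mk0 a.1 fun h => by simpa [h] using a.2, by
          rw [MonoidHom.mem_ker]
          ext
          apply (algebraMap F E).injective
          simp [f, ← hnorm, a.2]⟩
        invFun := fun u => ⟨u.1, by
          have h : f u.1 = 1 := u.2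
          have h2 : Algebra.norm F (u.1 : E) = 1 := congrArg Units.val h
          rw [hnorm, h2, map_one]⟩
        left_inv := fun a => rfl
        right_inv := fun u => Subtype.ext (Units.ext rfl) }
    have h1 := f.ker.card_mul_index
    rw [Subgroup.index_ker, MonoidHom.range_eq_top.2 (FiniteField.unitsMap_norm_surjective F E),
      Subgroup.card_top, Nat.card_units, Nat.card_units, hcard,
      Nat.card_eq_fintype_card (α := F), ← Nat.card_congr e] at h1
    obtain ⟨j, hj⟩ : ∃ j, Fintype.card F = j + 2 := ⟨Fintype.card F - 2, by omega⟩
    rw [hj] at h1 ⊢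
    rw [show j + 2 - 1 = j + 1 by omega] at h1
    apply Nat.eq_of_mul_eq_mul_right (show 0 < j + 1 by omega)
    rw [h1]
    have : (j + 2) ^ 2 = (j + 2 + 1) * (j + 1) + 1 := by ring
    omega
  have hfib : ∀ c : F, c ≠ 0 →
      Nat.card {a : E // star a * a = algebraMap F E c} = Fintype.card F + 1 := by
    intro c hc
    obtain ⟨d, hd⟩ := FiniteField.norm_surjective F E c
    have hdd : star d * d = algebraMap F E c := by rw [hnorm, hd]
    have hc' : algebraMap F E c ≠ 0 := by simpa using hc
    have hd0 : d ≠ 0 := by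
      rintro rfl
      exact hc' (by rw [← hdd, mul_zero])
    rw [← hker]
    refine Nat.card_congr
      { toFun := fun a => ⟨a.1 * d⁻¹, ?_⟩
        invFun := fun a => ⟨a.1 * d, ?_⟩
        left_inv := fun a => Subtype.ext (inv_mul_cancel_right₀ hd0 _)
        right_inv := fun a => Subtype.ext (mul_inv_cancel_right₀ hd0 _) }
    · have h := a.2
      rw [hnorm] at hdd h ⊢
      rw [map_mul, map_mul, h, ← hdd, ← map_mul, ← map_mul, mul_inv_cancel₀ hd0]
      simp
    · have h := a.2
      rw [hnorm] at hdd h ⊢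
      rw [map_mul, map_mul, h, hdd, one_mul]
  have hzero : Nat.card {a : E // star a * a = 0} = 1 := by
    rw [Nat.card_eq_one_iff_unique]
    refine ⟨⟨fun a b => ?_⟩, ⟨⟨0, by simp⟩⟩⟩
    have : ∀ a : {a : E // star a * a = 0}, a.1 = 0 := by
      intro a
      have h := a.2
      rw [hstar, ← pow_succ] at h
      exact pow_eq_zero_iff (by omega) |>.1 h
    exact Subtype.ext ((this a).trans (this b).symm)
  have hb := card_unit_bounds hfix (ε := -1) (Or.inr rfl) hcard hzero hfib
    (by push_cast; ring) (by push_cast; ring)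
  refine ⟨fun c => (FiniteField.frobeniusAlgHom F E).commutes c, hfix, ?_, ?_, fun m => (hb m).1,
    fun m => (hb m).2⟩
  · intro c _
    obtain ⟨d, hd⟩ := FiniteField.norm_surjective F E c
    exact ⟨d, by rw [hnorm, hd]⟩
  · intro a h
    by_contra ha
    have h1 := h a⁻¹
    rw [inv_mul_cancel₀ ha, star_one, one_add_one_eq_two] at h1
    have h2 : algebraMap F E 2 = 0 := by rw [map_ofNat]; exact h1
    exact QuadraticStar.two_ne_zero hodd ((map_eq_zero _).1 h2)

end Frobenius

/-! ### Plane involutions, the centre and `zeta0` -/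

section Involutions

/-- Let d be the gcd of m and the order of x. The order of x ^ m being 2 means that x has order 2d,
and m is an odd multiple of d. So x ^ m = x ^ d, the involution of the cyclic group. -/
theorem zeta0_eq_of_pow {G : Type*} [Group G] {i g z : G} {m : ℕ} (hz : orderOf z = 2)
    (h : (i * (g⁻¹ * i * g)) ^ m = z) : zeta0 i g = z := by
  set x := i * (g⁻¹ * i * g) with hx
  have h2 : z ^ 2 = 1 := by rw [← hz, pow_orderOf_eq_one]
  have hz1 : z ≠ 1 := by
    rintro rfl
    simp at hz
  have hx1 : x ^ (m * 2) = 1 := by rw [pow_mul, h, h2]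
  have hm0 : m ≠ 0 := by
    rintro rfl
    exact hz1 (by rw [← h, pow_zero])
  have hfin : IsOfFinOrder x := isOfFinOrder_iff_pow_eq_one.2 ⟨m * 2, by omega, hx1⟩
  have hord := IsOfFinOrder.orderOf_pow x m hfin
  rw [h, hz] at hord
  have hmul : orderOf x = 2 * (orderOf x).gcd m :=
    (Nat.div_eq_iff_eq_mul_left (Nat.gcd_pos_of_pos_left _ hfin.orderOf_pos)
      (Nat.gcd_dvd_left _ _)).1 hord.symm
  set d := (orderOf x).gcd m with hd
  obtain ⟨j, hj⟩ : d ∣ m := Nat.gcd_dvd_right _ _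
  have heven : Even (orderOf x) := by rw [hmul]; exact even_two_mul d
  have hodd : Odd j := by
    rw [← Nat.not_even_iff_odd]
    rintro ⟨l, hl⟩
    apply hz1
    rw [← h, hj, hl, show d * (l + l) = 2 * d * l by ring, pow_mul, ← hmul, pow_orderOf_eq_one,
      one_pow]
  obtain ⟨l, hl⟩ := hodd
  have hdiv : orderOf x / 2 = d := by omega
  rw [zeta0, ← hx, if_pos heven, involutionOf, hdiv, ← h, hj, hl,
    show d * (2 * l + 1) = 2 * d * l + d by ring, pow_add, pow_mul, ← hmul, pow_orderOf_eq_one,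
    one_pow, one_mul]

variable {F A : Type*} [Field F] [Fintype F] [CommRing A] [StarRing A] [Algebra F A]
  {r : Type*} [Fintype r] [DecidableEq r]

/-- The special unitary involution with `-1`-eigenspace the image of the given isometry. -/
def planeInvolution (Z : Isom A r (Fin 2)) : Matrix.specialUnitaryGroup r A :=
  ⟨inflate Z.1 (-1), inflate_mem_specialUnitary Z.2 neg_one_mem_specialUnitary_two⟩

theorem planeInvolution_mul_self (Z : Isom A r (Fin 2)) :
    planeInvolution Z * planeInvolution Z = 1 := by
  apply Subtype.ext
  change inflate Z.1 (-1) * inflate Z.1 (-1) = 1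
  rw [inflate_mul Z.2, neg_mul_neg, one_mul, inflate_one]

theorem conj_planeInvolution (g : Matrix.specialUnitaryGroup r A) (Z : Isom A r (Fin 2)) :
    g * planeInvolution Z * g⁻¹ = planeInvolution (moveIsom g Z) :=
  Subtype.ext (conj_inflate (specialUnitary_mul_conjTranspose g) Z.1 (-1))

theorem inflate_injective {P : Matrix r (Fin 2) A} (hP : Pᴴ * P = 1) :
    Function.Injective (inflate P) := by
  intro b c h
  have h1 := congrArg (fun M => Pᴴ * (M * P)) h
  simpa only [inflate_mul_self hP, ← Matrix.mul_assoc, hP, Matrix.one_mul] using h1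

/-- A central element fixing one unit vector fixes its whole orbit, hence every basis vector by
transitivity. -/
theorem QuadraticStar.eq_one_of_central [Nontrivial A] (hA : QuadraticStar F A)
    (hr : 2 ≤ Fintype.card r) {z : Matrix.specialUnitaryGroup r A}
    (hz : z ∈ Subgroup.center (Matrix.specialUnitaryGroup r A)) (v : Isom A r (Fin 1))
    (hv : z.1 * v.1 = v.1) : z = 1 := by
  apply Subtype.ext
  ext i j
  let w : Isom A r (Fin 1) := ⟨Matrix.of fun i _ => if i = j then 1 else 0, by
    ext a b
    rw [Subsingleton.elim a b]
    simp [Matrix.mul_apply]⟩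
  obtain ⟨x, hx⟩ := hA.exists_moveIsom_eq (by simp; omega) v w
  have hzx : z.1 * x.1 = x.1 * z.1 := congrArg Subtype.val (Subgroup.mem_center_iff.1 hz x).symm
  have hxv : x.1 * v.1 = w.1 := congrArg Subtype.val hx
  have hzw : z.1 * w.1 = w.1 := by
    rw [← hxv, ← Matrix.mul_assoc, hzx, Matrix.mul_assoc, hv]
  have := congrFun₂ hzw i 0
  simpa [w, Matrix.mul_apply, Matrix.one_apply] using this

theorem QuadraticStar.eq_one_of_central_of_inflate [Nontrivial A] (hA : QuadraticStar F A)
    (hr : 3 ≤ Fintype.card r) {z : Matrix.specialUnitaryGroup r A}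
    (hz : z ∈ Subgroup.center (Matrix.specialUnitaryGroup r A)) (P : Isom A r (Fin 2))
    {b : Matrix (Fin 2) (Fin 2) A} (hb : z.1 = inflate P.1 b) : z = 1 := by
  -- Rank at least 3 leaves a unit vector orthogonal to the plane, and this vector is fixed.
  obtain ⟨y, hy, hPy⟩ := hA.exists_unit_orthogonal P.2 (by simp; omega)
  refine hA.eq_one_of_central (by omega) hz ⟨y, hy⟩ ?_
  rw [hb]
  exact inflate_mul_of_orthogonal hPy b

theorem QuadraticStar.isUnit_two [Nontrivial A] (hodd : Odd (Fintype.card F)) :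
    IsUnit (2 : A) := by
  have h := (IsUnit.mk0 (2 : F) (QuadraticStar.two_ne_zero hodd)).map (algebraMap F A)
  rwa [map_ofNat] at h

theorem QuadraticStar.planeInvolution_ne_one [Nontrivial A] (hodd : Odd (Fintype.card F))
    (Z : Isom A r (Fin 2)) : planeInvolution Z ≠ 1 := by
  intro h
  have h1 : inflate Z.1 (-1) = inflate Z.1 1 := by
    rw [inflate_one]
    exact congrArg Subtype.val h
  have h2 := congrFun₂ (inflate_injective Z.2 h1) 0 0
  have h3 : (2 : A) = 0 := by
    rw [Matrix.neg_apply, Matrix.one_apply_eq] at h2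
    linear_combination -h2
  have := QuadraticStar.isUnit_two (F := F) (A := A) hodd
  rw [h3] at this
  exact not_isUnit_zero this

theorem QuadraticStar.planeInvolution_not_central [Nontrivial A] (hA : QuadraticStar F A)
    (hodd : Odd (Fintype.card F)) (hr : 3 ≤ Fintype.card r) (Z : Isom A r (Fin 2)) :
    planeInvolution Z ∉ Subgroup.center (Matrix.specialUnitaryGroup r A) := fun h =>
  QuadraticStar.planeInvolution_ne_one hodd Z (hA.eq_one_of_central_of_inflate hr h Z rfl)

/-- An involution of the special unitary group of a plane is `-1`. -/
theorem QuadraticStar.eq_neg_one_of_sq [Nontrivial A] (hA : QuadraticStar F A)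
    (hodd : Odd (Fintype.card F)) {b : Matrix (Fin 2) (Fin 2) A} (hb : bᴴ * b = 1)
    (hdet : b.det = 1) (hbb : b * b = 1) (hb1 : b ≠ 1) : b = -1 := by
  have h2 := QuadraticStar.isUnit_two (F := F) (A := A) hodd
  rw [Matrix.det_fin_two] at hdet
  have e00 := congrFun₂ hbb 0 0
  have e01 := congrFun₂ hbb 0 1
  have e10 := congrFun₂ hbb 1 0
  have e11 := congrFun₂ hbb 1 1
  simp only [Matrix.mul_apply, Fin.sum_univ_two, Matrix.one_apply, Fin.isValue, zero_ne_one,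
    one_ne_zero, if_true, if_false] at e00 e01 e10 e11
  -- By Cayley–Hamilton the trace of b times b equals b² + 1 = 2. As 2 is a unit, so is the trace,
  -- and b is scalar.
  have t0 : (b 0 0 + b 1 1) * b 0 0 = 2 := by linear_combination e00 + hdet
  have t1 : (b 0 0 + b 1 1) * b 1 1 = 2 := by linear_combination e11 + hdet
  have tu : IsUnit (b 0 0 + b 1 1) := isUnit_of_mul_isUnit_left (t0 ▸ h2)
  have h01 : b 0 1 = 0 := tu.mul_right_eq_zero.1 (by linear_combination e01)
  have h10 : b 1 0 = 0 := tu.mul_right_eq_zero.1 (by linear_combination e10)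
  have h11 : b 1 1 = b 0 0 := tu.mul_left_cancel (t1.trans t0.symm)
  have hs : b 0 0 * b 0 0 = 1 := by rw [h01] at e00; linear_combination e00
  have hn : star (b 0 0) * b 0 0 = 1 := by
    have := congrFun₂ hb 0 0
    simpa [Matrix.mul_apply, Fin.sum_univ_two, h10] using this
  -- Over `F × F` the scalar 1 has square roots such as (1, -1); unitarity excludes these, since a
  -- unitary square root of 1 is fixed by the star and so lies in `F`.
  have hfix : star (b 0 0) = b 0 0 := by linear_combination b 0 0 * hn - star (b 0 0) * hs
  obtain ⟨c, hc⟩ := hA.exists_of_star_eq _ hfix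
  have hcc : c * c = 1 := by
    apply (algebraMap F A).injective
    rw [map_mul, hc, hs, map_one]
  rcases mul_self_eq_one_iff.1 hcc with rfl | rfl
  · exfalso
    apply hb1
    rw [map_one] at hc
    ext i j
    fin_cases i <;> fin_cases j <;> simp [h01, h10, h11, ← hc]
  · rw [map_neg, map_one] at hc
    ext i j
    fin_cases i <;> fin_cases j <;> simp [h01, h10, h11, ← hc]

end Involutions

/-! ### Passing to the central quotient -/

section Transfer

variable {F A : Type*} [Field F] [Fintype F] [CommRing A] [StarRing A] [Algebra F A]
  {r : Type*} [Fintype r] [DecidableEq r] {H : Type*} [Group H]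
  (e : H ≃* Matrix.specialUnitaryGroup r A)

theorem mem_center_iff_of_equiv (h : H) : h ∈ Subgroup.center H ↔
    e h ∈ Subgroup.center (Matrix.specialUnitaryGroup r A) := by
  rw [Subgroup.mem_center_iff, Subgroup.mem_center_iff]
  constructor
  · intro hh g
    have := congrArg e (hh (e.symm g))
    simpa using this
  · intro hh g
    apply e.injective
    rw [map_mul, map_mul, hh]

theorem QuadraticStar.orderOf_mk_planeInvolution [Nontrivial A] (hA : QuadraticStar F A)
    (hodd : Odd (Fintype.card F)) (hr : 3 ≤ Fintype.card r) (Z : Isom A r (Fin 2)) :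
    orderOf (QuotientGroup.mk (e.symm (planeInvolution Z)) : H ⧸ Subgroup.center H) = 2 := by
  apply orderOf_eq_prime
  · rw [pow_two, ← QuotientGroup.mk_mul, ← map_mul, planeInvolution_mul_self, map_one,
      QuotientGroup.mk_one]
  · rw [Ne, QuotientGroup.eq_one_iff, mem_center_iff_of_equiv e, e.apply_symm_apply]
    exact hA.planeInvolution_not_central hodd hr Z

/-- If `L` acts by plane matrices, then every involution of a conjugate of the image of `L` in the
central quotient is the image of a plane involution. -/
theorem QuadraticStar.exists_planeInvolution [Nontrivial A] (hA : QuadraticStar F A)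
    (hodd : Odd (Fintype.card F)) (hr : 3 ≤ Fintype.card r) {L : Subgroup H}
    {P : Isom A r (Fin 2)} (hL : ∀ u ∈ L, ∃ b, (e u).1 = inflate P.1 b)
    {g i : H ⧸ Subgroup.center H}
    (hi : i ∈ (L.map (QuotientGroup.mk' (Subgroup.center H))).map (MulAut.conj g).toMonoidHom)
    (hi2 : orderOf i = 2) :
    ∃ P' : Isom A r (Fin 2), i = QuotientGroup.mk (e.symm (planeInvolution P')) := by
  obtain ⟨y, ⟨u, hu, rfl⟩, rfl⟩ := hi
  obtain ⟨x, rfl⟩ := QuotientGroup.mk_surjective g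
  obtain ⟨b, hb⟩ := hL u hu
  have hord : orderOf (QuotientGroup.mk u : H ⧸ Subgroup.center H) = 2 := by
    rw [← hi2]
    exact (orderOf_injective (MulAut.conj (QuotientGroup.mk x)).toMonoidHom
      (MulEquiv.injective _) _).symm
  have hu2 : u * u ∈ Subgroup.center H := by
    rw [← QuotientGroup.eq_one_iff, QuotientGroup.mk_mul, ← pow_two, ← hord, pow_orderOf_eq_one]
  have hu1 : u ∉ Subgroup.center H := by
    intro h
    rw [(QuotientGroup.eq_one_iff u).2 h, orderOf_one] at hord
    omega
  have hsq : (e u).1 * (e u).1 = inflate P.1 (b * b) := by rw [hb, inflate_mul P.2]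
  -- The square of the lift is central and trivial off a plane, hence equal to 1: the involution of
  -- the quotient lifts to an involution.
  have hone : e u * e u = 1 := by
    refine hA.eq_one_of_central_of_inflate hr ?_ P (b := b * b) hsq
    rw [← map_mul, ← mem_center_iff_of_equiv e]
    exact hu2
  have hbb : b * b = 1 := by
    apply inflate_injective P.2
    rw [← hsq, inflate_one]
    exact congrArg Subtype.val hone
  have hunit : bᴴ * b = 1 := by
    apply inflate_injective P.2
    rw [← inflate_mul P.2, ← conjTranspose_inflate, ← hb, inflate_one]
    exact specialUnitary_isometry _
  have hdet : b.det = 1 := by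
    rw [← det_inflate P.2, ← hb]
    exact (Matrix.mem_specialUnitaryGroup_iff.1 (e u).2).2
  have hb1 : b ≠ 1 := by
    rintro rfl
    rw [inflate_one] at hb
    have : e u = 1 := Subtype.ext hb
    rw [map_eq_one_iff e e.injective] at this
    exact hu1 (this ▸ one_mem _)
  have hbm := hA.eq_neg_one_of_sq hodd hunit hdet hbb hb1
  have heu : e u = planeInvolution P := Subtype.ext (by rw [hb, hbm]; rfl)
  refine ⟨moveIsom (e x) P, ?_⟩
  rw [← conj_planeInvolution, ← heu, ← map_mul, ← map_inv, ← map_mul, e.symm_apply_apply]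
  rfl

/-- If a conjugate of `L` contains one plane involution, then every plane involution is contained
in one. -/
theorem QuadraticStar.exists_mem_conj [Nontrivial A] (hA : QuadraticStar F A)
    (hr : 3 ≤ Fintype.card r) {L : Subgroup H} {P : Isom A r (Fin 2)}
    (hL : ∃ h ∈ L, e h = planeInvolution P) (Z : Isom A r (Fin 2)) :
    ∃ g : H ⧸ Subgroup.center H, QuotientGroup.mk (e.symm (planeInvolution Z)) ∈
      (L.map (QuotientGroup.mk' (Subgroup.center H))).map (MulAut.conj g).toMonoidHom := by
  obtain ⟨h, hhL, hh⟩ := hL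
  obtain ⟨x, hx⟩ := hA.exists_moveIsom_eq (by simp; omega) P Z
  refine ⟨QuotientGroup.mk (e.symm x), QuotientGroup.mk h, ⟨h, hhL, rfl⟩, ?_⟩
  rw [← hx, ← conj_planeInvolution, ← hh, map_mul, map_mul, map_inv, e.symm_apply_apply]
  rfl

theorem card_preimage_mk {H : Type*} [Group H] (N : Subgroup H) (p : H ⧸ N → Prop) :
    Nat.card {h : H // p (QuotientGroup.mk h)} = Nat.card N * Nat.card {g : H ⧸ N // p g} := by
  rw [← Nat.card_prod]
  exact Nat.card_congr (QuotientGroup.preimageMkEquivSubgroupProdSet N {g | p g})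

/-- The probability bound for a group isomorphic to a special unitary group. -/
theorem QuadraticStar.uniformProb_ge [Nontrivial A] [Finite A] (hA : QuadraticStar F A)
    (hodd : Odd (Fintype.card F)) (hq : 3 < Fintype.card F) (hr : 3 ≤ Fintype.card r)
    {p : H ⧸ Subgroup.center H → Prop}
    (hp : ∀ Z : Isom A r (Fin 2), p (QuotientGroup.mk (e.symm (planeInvolution Z))))
    (P : Isom A r (Fin 2)) :
    1 / 750 * (1 - 2 / (Fintype.card F : ℝ)) ≤ uniformProb fun g : H ⧸ Subgroup.center H =>
      p (zeta0 (QuotientGroup.mk (e.symm (planeInvolution P))) g) := by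
  have hfin : Finite H := Finite.of_equiv _ e.symm.toEquiv
  set i : H ⧸ Subgroup.center H := QuotientGroup.mk (e.symm (planeInvolution P)) with hi
  have hmain := hA.good_fraction hodd hq hr P
  have hle : Nat.card {g : Matrix.specialUnitaryGroup r A // IsGood P.1 (moveIsom g P).1} ≤
      Nat.card {h : H // p (zeta0 i (QuotientGroup.mk h))} := by
    -- The inverse appears because `zeta0` conjugates as g⁻¹ i g, while moving isometries by g
    -- conjugates as g i g⁻¹.
    refine Nat.card_le_card_of_injective (fun g => ⟨e.symm g.1⁻¹, ?_⟩) ?_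
    · obtain ⟨m, Z, hZ, hm⟩ := g.2
      have hpow : (planeInvolution P * (g.1 * planeInvolution P * g.1⁻¹)) ^ m =
          planeInvolution ⟨Z, hZ⟩ := by
        rw [conj_planeInvolution]
        exact Subtype.ext hm
      have hz := zeta0_eq_of_pow (i := i) (g := QuotientGroup.mk (e.symm g.1⁻¹)) (m := m)
        (hA.orderOf_mk_planeInvolution e hodd hr ⟨Z, hZ⟩) (by
          rw [← hpow, hi]
          simp only [map_mul, map_pow, map_inv, inv_inv, QuotientGroup.mk_mul, QuotientGroup.mk_pow,
            QuotientGroup.mk_inv])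
      rw [hz]
      exact hp _
    · intro g g' h
      have h1 : e.symm g.1⁻¹ = e.symm g'.1⁻¹ := congrArg Subtype.val h
      exact Subtype.ext (inv_injective (e.symm.injective h1))
  have hcH : Nat.card H = Nat.card (Matrix.specialUnitaryGroup r A) := Nat.card_congr e.toEquiv
  have h1 := card_preimage_mk (Subgroup.center H) fun g => p (zeta0 i g)
  have h2 := Subgroup.card_eq_card_quotient_mul_card_subgroup (Subgroup.center H)
  have hN : (0 : ℝ) < Nat.card (Subgroup.center H) := by exact_mod_cast Nat.card_pos
  have hQ : (0 : ℝ) < Nat.card (H ⧸ Subgroup.center H) := by exact_mod_cast Nat.card_pos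
  rw [uniformProb, le_div_iff₀ hQ]
  refine le_of_mul_le_mul_right ?_ hN
  rw [← hcH, h2] at hmain
  rw [h1] at hle
  have hle' : (Nat.card {g : Matrix.specialUnitaryGroup r A // IsGood P.1 (moveIsom g P).1} : ℝ) ≤
      Nat.card (Subgroup.center H) *
        Nat.card {g : H ⧸ Subgroup.center H // p (zeta0 i g)} := by exact_mod_cast hle
  push_cast at hmain
  linarith

end Transfer

/-! ### Root subgroups acting on coordinate planes -/

section CoordinatePlanes

variable {r : Type*} [Fintype r] [DecidableEq r]

/-- The inclusion of the coordinate plane spanned by the basis vectors `a` and `b`. -/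
def coordPlane (R : Type*) [CommRing R] (a b : r) : Matrix r (Fin 2) R :=
  Matrix.single a 0 1 + Matrix.single b 1 1

variable {R : Type*} [CommRing R]

theorem diag_pair_mul_single {a b : r} (hab : a ≠ b) (t : R) :
    (Matrix.single a a 1 + Matrix.single b b 1) * Matrix.single a b t = Matrix.single a b t := by
  simp [add_mul, Matrix.single_mul_single_of_ne _ _ _ _ hab.symm]

theorem single_mul_diag_pair {a b : r} (hab : a ≠ b) (t : R) :
    Matrix.single a b t * (Matrix.single a a 1 + Matrix.single b b 1) = Matrix.single a b t := by
  simp [mul_add, Matrix.single_mul_single_of_ne _ _ _ _ hab.symm]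

variable [StarRing R]

theorem conjTranspose_coordPlane (a b : r) :
    (coordPlane R a b)ᴴ = Matrix.single 0 a 1 + Matrix.single 1 b 1 := by
  simp [coordPlane, Matrix.conjTranspose_single]

theorem coordPlane_isometry {a b : r} (hab : a ≠ b) :
    (coordPlane R a b)ᴴ * coordPlane R a b = 1 := by
  rw [conjTranspose_coordPlane, coordPlane]
  simp only [Matrix.add_mul, Matrix.mul_add, Matrix.single_mul_single_same,
    Matrix.single_mul_single_of_ne _ _ _ _ hab, Matrix.single_mul_single_of_ne _ _ _ _ hab.symm]
  ext i j
  fin_cases i <;> fin_cases j <;> simp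

theorem coordPlane_conj (a b : r) (X : Matrix (Fin 2) (Fin 2) R) :
    coordPlane R a b * X * (coordPlane R a b)ᴴ = Matrix.single a a (X 0 0) +
      Matrix.single a b (X 0 1) + Matrix.single b a (X 1 0) + Matrix.single b b (X 1 1) := by
  rw [conjTranspose_coordPlane, coordPlane]
  simp only [Matrix.add_mul, Matrix.mul_add, Matrix.single_mul_mul_single, one_mul, mul_one]
  abel

theorem coordPlane_mul_conjTranspose (a b : r) :
    coordPlane R a b * (coordPlane R a b)ᴴ = Matrix.single a a 1 + Matrix.single b b 1 := by
  have h := coordPlane_conj a b (1 : Matrix (Fin 2) (Fin 2) R)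
  rw [Matrix.mul_one] at h
  rw [h]
  simp

theorem inflate_coordPlane_neg_one (a b : r) :
    inflate (coordPlane R a b) (-1) =
      1 - (2 : R) • (Matrix.single a a (1 : R) + Matrix.single b b 1) := by
  rw [inflate_neg_one, coordPlane_mul_conjTranspose]

/-- The product of the three transvections is the Weyl element with rows (0, t) and (-1/t, 0), whose
square is -1 on the plane. It exhibits the plane involution inside the group generated by opposite
root elements. -/
theorem transvection_weyl_sq {K : Type*} [Field K] {a b : r} (hab : a ≠ b) {t : K} (ht : t ≠ 0) :
    ((1 + Matrix.single a b t) * (1 + Matrix.single b a (-t⁻¹)) * (1 + Matrix.single a b t)) ^ 2 =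
      1 - (2 : K) • (Matrix.single a a (1 : K) + Matrix.single b b 1) := by
  -- The trivial star makes the calculus of `inflate` available over any field.
  let : StarRing K := starRingOfComm
  have hP := coordPlane_isometry (R := K) hab
  have h1 : (1 + Matrix.single a b t) = inflate (coordPlane K a b) !![1, t; 0, 1] := by
    rw [inflate, coordPlane_conj]
    simp
  have h2 : (1 + Matrix.single b a (-t⁻¹)) = inflate (coordPlane K a b) !![1, 0; -t⁻¹, 1] := by
    rw [inflate, coordPlane_conj]
    simp
  rw [h1, h2, inflate_mul hP, inflate_mul hP, inflate_pow hP, ← inflate_coordPlane_neg_one]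
  congr 1
  ext i j
  fin_cases i <;> fin_cases j <;> simp [Matrix.mul_apply, Fin.sum_univ_two, pow_two, ht]

variable {H : Type*} [Group H] (e : H ≃* Matrix.specialUnitaryGroup r R)

theorem exists_inflate_of_closure {P : Matrix r (Fin 2) R} (hP : Pᴴ * P = 1) {s : Set H}
    (hs : ∀ u ∈ s, ∃ b, (e u).1 = inflate P b) :
    ∀ u ∈ Subgroup.closure s, ∃ b, (e u).1 = inflate P b := by
  intro u hu
  induction hu using Subgroup.closure_induction with
  | mem x hx => exact hs x hx
  | one => exact ⟨1, by rw [map_one, inflate_one]; rfl⟩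
  | mul x y _ _ hx hy =>
    obtain ⟨b, hb⟩ := hx
    obtain ⟨c, hc⟩ := hy
    exact ⟨b * c, by rw [map_mul, ← inflate_mul hP, ← hb, ← hc]; rfl⟩
  | inv x _ hx =>
    obtain ⟨b, hb⟩ := hx
    exact ⟨bᴴ, by rw [map_inv, ← conjTranspose_inflate, ← hb]; rfl⟩

/-- Since `P * Pᴴ` is the projection onto the plane, the hypotheses say that `X` lives on the plane
from both sides. -/
theorem one_add_eq_inflate {P : Matrix r (Fin 2) R} {X : Matrix r r R}
    (h1 : P * Pᴴ * X = X) (h2 : X * (P * Pᴴ) = X) :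
    1 + X = inflate P (1 + Pᴴ * X * P) := by
  rw [inflate, add_sub_cancel_left]
  congr 1
  calc X = P * Pᴴ * X * (P * Pᴴ) := by rw [h1, h2]
    _ = _ := by simp only [Matrix.mul_assoc]

end CoordinatePlanes

/-! ### `PSL_n(q)` as a unitary group over `F × F` -/

section Linear

variable {n : ℕ} {F : Type*} [Field F]

/-- The matrix over `F × F` with the given components, the second one transposed. -/
def pairMatrix (X Y : Matrix (Fin n) (Fin n) F) : Matrix (Fin n) (Fin n) (SplitDouble F) :=
  Matrix.of fun i j => (X i j, Y j i)

variable (F) in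
/-- The first projection of `F × F`. -/
def SplitDouble.fst : SplitDouble F →+* F := RingHom.fst F F

variable (F) in
/-- The second projection of `F × F`. -/
def SplitDouble.snd : SplitDouble F →+* F := RingHom.snd F F

theorem SplitDouble.ext {a b : SplitDouble F} (h1 : SplitDouble.fst F a = SplitDouble.fst F b)
    (h2 : SplitDouble.snd F a = SplitDouble.snd F b) : a = b := Prod.ext h1 h2

theorem pairMatrix_map_fst (X Y : Matrix (Fin n) (Fin n) F) :
    (pairMatrix X Y).map (SplitDouble.fst F) = X := rfl

theorem pairMatrix_map_snd (X Y : Matrix (Fin n) (Fin n) F) :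
    (pairMatrix X Y).map (SplitDouble.snd F) = Yᵀ := rfl

theorem splitMatrix_ext {M N : Matrix (Fin n) (Fin n) (SplitDouble F)}
    (h1 : M.map (SplitDouble.fst F) = N.map (SplitDouble.fst F))
    (h2 : M.map (SplitDouble.snd F) = N.map (SplitDouble.snd F)) : M = N := by
  ext i j
  exact SplitDouble.ext (congrFun₂ h1 i j) (congrFun₂ h2 i j)

theorem pairMatrix_mul (X Y X' Y' : Matrix (Fin n) (Fin n) F) :
    pairMatrix X Y * pairMatrix X' Y' = pairMatrix (X * X') (Y' * Y) := by
  apply splitMatrix_ext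
  · rw [Matrix.map_mul, pairMatrix_map_fst, pairMatrix_map_fst, pairMatrix_map_fst]
  · rw [Matrix.map_mul, pairMatrix_map_snd, pairMatrix_map_snd, pairMatrix_map_snd,
      Matrix.transpose_mul]

theorem pairMatrix_one : pairMatrix (1 : Matrix (Fin n) (Fin n) F) 1 = 1 := by
  apply splitMatrix_ext
  · rw [pairMatrix_map_fst, Matrix.map_one _ (map_zero _) (map_one _)]
  · rw [pairMatrix_map_snd, Matrix.map_one _ (map_zero _) (map_one _), Matrix.transpose_one]

/-- Transposing the second component cancels the transpose in the adjoint, leaving only the swap. So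
a pair (X, Y) is unitary exactly when XY = 1. -/
theorem conjTranspose_pairMatrix (X Y : Matrix (Fin n) (Fin n) F) :
    (pairMatrix X Y)ᴴ = pairMatrix Y X := rfl

theorem map_fst_conjTranspose (M : Matrix (Fin n) (Fin n) (SplitDouble F)) :
    Mᴴ.map (SplitDouble.fst F) = (M.map (SplitDouble.snd F))ᵀ := rfl

theorem det_pairMatrix (X Y : Matrix (Fin n) (Fin n) F) :
    (pairMatrix X Y).det = (X.det, Y.det) := by
  apply SplitDouble.ext
  · rw [RingHom.map_det]
    rfl
  · rw [RingHom.map_det]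
    exact Y.det_transpose

theorem pairMatrix_add (X Y X' Y' : Matrix (Fin n) (Fin n) F) :
    pairMatrix (X + X') (Y + Y') = pairMatrix X Y + pairMatrix X' Y' := rfl

theorem pairMatrix_diag_pair (a b : Fin n) :
    pairMatrix (Matrix.single a a (1 : F) + Matrix.single b b 1)
      (Matrix.single a a (1 : F) + Matrix.single b b 1) =
      Matrix.single a a 1 + Matrix.single b b 1 := by
  apply splitMatrix_ext
  · rw [pairMatrix_map_fst, Matrix.map_add _ (map_add _), Matrix.map_single, Matrix.map_single,
      map_one]
  · rw [pairMatrix_map_snd, Matrix.map_add _ (map_add _), Matrix.map_single, Matrix.map_single,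
      map_one, Matrix.transpose_add, Matrix.transpose_single, Matrix.transpose_single]

/-- The first component of a special unitary matrix over `F × F`. -/
def specialUnitaryFst (M : Matrix.specialUnitaryGroup (Fin n) (SplitDouble F)) :
    Matrix.SpecialLinearGroup (Fin n) F :=
  ⟨M.1.map (SplitDouble.fst F), by
    have h := congrArg (SplitDouble.fst F) (Matrix.mem_specialUnitaryGroup_iff.1 M.2).2
    rwa [RingHom.map_det, map_one] at h⟩

theorem pairMatrix_specialUnitaryFst
    (M : Matrix.specialUnitaryGroup (Fin n) (SplitDouble F)) :
    pairMatrix (specialUnitaryFst M).1 ((specialUnitaryFst M)⁻¹).1 = M.1 := by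
  refine splitMatrix_ext rfl ?_
  have h := congrArg (fun N => N.map (SplitDouble.fst F)) (specialUnitary_isometry M)
  simp only [Matrix.map_mul, map_fst_conjTranspose,
    Matrix.map_one _ (map_zero _) (map_one _)] at h
  have h2 : (specialUnitaryFst M).1 * ((specialUnitaryFst M)⁻¹).1 = 1 :=
    congrArg Subtype.val (mul_inv_cancel (specialUnitaryFst M))
  rw [pairMatrix_map_snd, ← Matrix.transpose_inj, Matrix.transpose_transpose]
  exact (left_inv_eq_right_inv h h2).symm

variable (n F) in
/-- The special linear group is the special unitary group over `F × F`. -/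
def slEquiv : Matrix.SpecialLinearGroup (Fin n) F ≃*
    Matrix.specialUnitaryGroup (Fin n) (SplitDouble F) where
  toFun g := ⟨pairMatrix g.1 (g⁻¹).1, by
    rw [Matrix.mem_specialUnitaryGroup_iff, Matrix.mem_unitaryGroup_iff,
      Matrix.star_eq_conjTranspose, conjTranspose_pairMatrix, pairMatrix_mul,
      ← Matrix.SpecialLinearGroup.coe_mul, mul_inv_cancel, det_pairMatrix, g.2, (g⁻¹).2]
    exact ⟨pairMatrix_one, rfl⟩⟩
  invFun := specialUnitaryFst
  left_inv g := rfl
  right_inv M := Subtype.ext (pairMatrix_specialUnitaryFst M)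
  map_mul' g h := by
    apply Subtype.ext
    change pairMatrix (g * h).1 ((g * h)⁻¹).1 = pairMatrix _ _ * pairMatrix _ _
    rw [pairMatrix_mul, mul_inv_rev]
    rfl

theorem slEquiv_transvection {a b : Fin n} (hab : a ≠ b) (t : F) :
    (slEquiv n F (Matrix.SpecialLinearGroup.transvection hab t)).1 =
      1 + pairMatrix (Matrix.single a b t) (Matrix.single a b (-t)) := by
  have hinv : (Matrix.SpecialLinearGroup.transvection hab t)⁻¹ =
      Matrix.SpecialLinearGroup.transvection hab (-t) :=
    inv_eq_of_mul_eq_one_right (Matrix.SpecialLinearGroup.transvection_mul_neg hab t)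
  change pairMatrix _ _ = _
  rw [hinv, ← pairMatrix_one, ← pairMatrix_add]
  rfl

theorem slEquiv_root_inflate {a b : Fin n} (hab : a ≠ b)
    {u : Matrix.SpecialLinearGroup (Fin n) F} (hu : u ∈ slRootSet hab) :
    ∃ c, (slEquiv n F u).1 = inflate (coordPlane (SplitDouble F) a b) c := by
  obtain ⟨t, rfl⟩ := hu
  rw [slEquiv_transvection]
  refine ⟨_, one_add_eq_inflate ?_ ?_⟩ <;>
  rw [coordPlane_mul_conjTranspose, ← pairMatrix_diag_pair, pairMatrix_mul,
    diag_pair_mul_single hab, single_mul_diag_pair hab]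

theorem slEquiv_root_closure {a b : Fin n} (hab : a ≠ b) :
    ∀ u ∈ Subgroup.closure (slRootSet (F := F) hab ∪ slRootSet hab.symm),
      ∃ c, (slEquiv n F u).1 = inflate (coordPlane (SplitDouble F) a b) c := by
  refine exists_inflate_of_closure _ (coordPlane_isometry hab) ?_
  rintro u (hu | hu)
  · exact slEquiv_root_inflate hab hu
  · obtain ⟨t, rfl⟩ := hu
    rw [slEquiv_transvection]
    refine ⟨_, one_add_eq_inflate ?_ ?_⟩ <;>
    rw [coordPlane_mul_conjTranspose, ← pairMatrix_diag_pair, pairMatrix_mul, add_comm,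
      diag_pair_mul_single hab.symm, single_mul_diag_pair hab.symm]

theorem exists_slEquiv_eq_planeInvolution {a b : Fin n} (hab : a ≠ b) :
    ∃ h ∈ Subgroup.closure (slRootSet (F := F) hab ∪ slRootSet hab.symm),
      slEquiv n F h =
        planeInvolution ⟨coordPlane (SplitDouble F) a b, coordPlane_isometry hab⟩ := by
  have hx := Subgroup.subset_closure (k := slRootSet (F := F) hab ∪ slRootSet hab.symm)
    (Or.inl ⟨1, rfl⟩)
  have hy := Subgroup.subset_closure (k := slRootSet (F := F) hab ∪ slRootSet hab.symm)
    (Or.inr ⟨-1⁻¹, rfl⟩)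
  refine ⟨_, pow_mem (mul_mem (mul_mem hx hy) hx) 2, ?_⟩
  -- Pulled back to the special linear group, the equation concerns first components only, where it
  -- is the Weyl element computation at t = 1.
  rw [← MulEquiv.eq_symm_apply]
  apply Subtype.ext
  refine (transvection_weyl_sq hab one_ne_zero).trans ?_
  change _ = (inflate (coordPlane (SplitDouble F) a b) (-1)).map (SplitDouble.fst F)
  rw [inflate_coordPlane_neg_one, ← pairMatrix_diag_pair, ← pairMatrix_one]
  rw [Matrix.map_sub _ (map_sub _), Matrix.map_smul' _ (2 : SplitDouble F) _ (map_mul _),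
    pairMatrix_map_fst, pairMatrix_map_fst, map_ofNat]

theorem PSL.uniformProb_classical_ge [Fintype F] (hn : 3 ≤ n) (hodd : Odd (Fintype.card F))
    (hq : 3 < Fintype.card F) {K : Subgroup (PSL n F)} (hK : PSL.IsLongRootSL2 K) {i : PSL n F}
    (hi : i ∈ K) (hi2 : orderOf i = 2) :
    1 / 750 * (1 - 2 / (Fintype.card F : ℝ)) ≤
      uniformProb fun g : PSL n F => PSL.IsClassicalInvolution (zeta0 i g) := by
  have hr : 3 ≤ Fintype.card (Fin n) := by simpa using hn
  obtain ⟨a, b, hab, g, rfl⟩ := hK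
  obtain ⟨P, rfl⟩ := quadraticStar_split.exists_planeInvolution (slEquiv n F) hodd hr
    (P := ⟨_, coordPlane_isometry hab⟩) (slEquiv_root_closure hab) hi hi2
  refine quadraticStar_split.uniformProb_ge (slEquiv n F) hodd hq hr (fun Z => ?_) P
  obtain ⟨g, hg⟩ := quadraticStar_split.exists_mem_conj (slEquiv n F) hr
    (exists_slEquiv_eq_planeInvolution hab) Z
  exact ⟨quadraticStar_split.orderOf_mk_planeInvolution (slEquiv n F) hodd hr Z, _,
    ⟨a, b, hab, g, rfl⟩, hg⟩

end Linear

/-! ### `PSU_n(q)` in an orthonormal basis -/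

section Unitary

variable {n : ℕ} {E : Type*} [Field E]

theorem hermGram_mul_apply (X : Matrix (Fin n) (Fin n) E) (i j : Fin n) :
    (hermGram n E * X) i j = X i.rev j := by
  simp [hermGram, Matrix.mul_apply]

theorem hermGram_mul_single (a b : Fin n) (t : E) :
    hermGram n E * Matrix.single a b t = Matrix.single a.rev b t := by
  ext i j
  simp only [hermGram_mul_apply, Matrix.single_apply, Fin.rev_eq_iff]

theorem single_mul_hermGram (a b : Fin n) (t : E) :
    Matrix.single a b t * hermGram n E = Matrix.single a b.rev t := by
  ext i j
  rw [Matrix.mul_apply, Finset.sum_eq_single b]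
  · simp only [Matrix.single_apply, hermGram, Matrix.of_apply]
    by_cases h1 : a = i <;> by_cases h2 : j = b.rev <;> simp [h1, h2, eq_comm]
  · intro k _ hk
    simp [hk.symm]
  · simp

/-- A basis change supported on the diagonal and the antidiagonal. -/
def crossMatrix (x y : Fin n → E) : Matrix (Fin n) (Fin n) E :=
  Matrix.of fun i j => (if i = j then x j else 0) + if i = j.rev then y j else 0

/-- The basis change preserves each hyperbolic plane spanned by a basis vector and its mirror, so it
commutes with the projection onto that plane. Root planes thus stay coordinate planes in the
orthonormal basis. -/
theorem crossMatrix_comm (x y : Fin n → E) (a : Fin n) :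
    (Matrix.single a a 1 + Matrix.single a.rev a.rev 1) * crossMatrix x y =
      crossMatrix x y * (Matrix.single a a 1 + Matrix.single a.rev a.rev 1) := by
  have hd (a : Fin n) : Matrix.single a a (1 : E) = Matrix.diagonal (Pi.single a 1) :=
    (Matrix.diagonal_single a 1).symm
  rw [hd, hd, Matrix.diagonal_add]
  ext i j
  rw [Matrix.diagonal_mul, Matrix.mul_diagonal, mul_comm]
  by_cases h1 : i = j
  · rw [h1]
  by_cases h2 : i = j.rev
  · have h3 : (Pi.single a 1 : Fin n → E) j.rev = (Pi.single a.rev 1 : Fin n → E) j := by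
      simp [Pi.single_apply, Fin.rev_eq_iff]
    have h4 : (Pi.single a.rev 1 : Fin n → E) j.rev = (Pi.single a 1 : Fin n → E) j := by
      simp [Pi.single_apply]
    rw [h2, h3, h4, add_comm]
  · simp [crossMatrix, h1, h2]

variable [StarRing E]

theorem conjTranspose_hermGram : (hermGram n E)ᴴ = hermGram n E := by
  ext i j
  simp only [Matrix.conjTranspose_apply, hermGram, Matrix.of_apply, apply_ite star, star_one,
    star_zero]
  congr 1
  rw [← Fin.rev_eq_iff, eq_iff_iff]
  exact eq_comm

theorem crossMatrix_form_apply (x y : Fin n → E) (i j : Fin n) :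
    ((crossMatrix x y)ᴴ * hermGram n E * crossMatrix x y) i j =
      (if i = j then star (x i) * y j + star (y i) * x j else 0) +
      if i = j.rev then star (x i) * x j + star (y i) * y j else 0 := by
  rw [Matrix.mul_assoc, Matrix.mul_apply]
  simp only [hermGram_mul_apply, Matrix.conjTranspose_apply, crossMatrix, Matrix.of_apply, star_add,
    apply_ite star, star_zero, add_mul, ite_mul, zero_mul, Finset.sum_add_distrib,
    Finset.sum_ite_eq', Finset.mem_univ, if_true, Fin.rev_rev, mul_add]
  have h1 : (i.rev = j) = (i = j.rev) := propext Fin.rev_eq_iff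
  have h2 : (i.rev = j.rev) = (i = j) := propext Fin.rev_inj
  simp only [h1, h2]
  split_ifs <;> ring

/-- For a hyperbolic pair e, f the vectors e + f/2 and δe - (δ/2)f are orthonormal when δ has norm
-1. -/
theorem exists_crossMatrix_form (h2 : (2 : E) ≠ 0) (hδ : ∃ δ : E, star δ * δ = -1) :
    ∃ x y : Fin n → E, (crossMatrix x y)ᴴ * hermGram n E * crossMatrix x y = 1 := by
  obtain ⟨δ, hδ⟩ := hδ
  -- At the middle index of odd n the diagonal and antidiagonal entries fall together and are added,
  -- so they must be 1 and 0.
  refine ⟨fun j => if j.rev < j then -δ / 2 else 1,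
    fun j => if j.rev < j then δ else if j < j.rev then 1 / 2 else 0, ?_⟩
  ext i j
  rw [crossMatrix_form_apply, Matrix.one_apply]
  have hs2 : star (2 : E) = 2 := star_ofNat 2
  by_cases h1 : i = j
  · subst h1
    rcases lt_trichotomy i i.rev with h | h | h
    · simp [h, h.ne, h.not_gt]
      field_simp
      norm_num
    · simp [← h]
    · simp [h, h.ne']
      field_simp
      linear_combination (-2) * hδ
  · rw [if_neg h1, if_neg h1, zero_add]
    by_cases h3 : i = j.rev
    · rw [if_pos h3]
      subst h3
      rcases lt_trichotomy j j.rev with h | h | h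
      · simp only [Fin.rev_rev, h, h.not_gt, if_true, if_false, star_div₀, star_neg, hs2]
        field_simp
        ring
      · exact absurd h.symm h1
      · simp only [Fin.rev_rev, h, h.not_gt, if_true, if_false, star_div₀, star_one, hs2]
        field_simp
        ring
    · rw [if_neg h3]

variable {F : Type*} [Field F] [Fintype F] [Algebra F E]

theorem mem_SU_iff (hstar : ∀ x : E, star x = FiniteField.frobeniusAlgHom F E x)
    (u : Matrix.SpecialLinearGroup (Fin n) E) :
    u ∈ SU n F E ↔ u.1ᴴ * hermGram n E * u.1 = hermGram n E := by
  have h : u.1ᴴ = (u.1.map (FiniteField.frobeniusAlgHom F E))ᵀ := by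
    ext i j
    exact hstar _
  rw [h]
  rfl

theorem transvection_mem_SU (hstar : ∀ x : E, star x = FiniteField.frobeniusAlgHom F E x)
    {a b : Fin n} (hab : a ≠ b) (hb : b = a.rev) {t : E} (ht : star t = -t) :
    Matrix.SpecialLinearGroup.transvection hab t ∈ SU n F E := by
  rw [mem_SU_iff hstar]
  change (1 + Matrix.single a b t)ᴴ * hermGram n E * (1 + Matrix.single a b t) = hermGram n E
  have ha : b.rev = a := by rw [hb, Fin.rev_rev]
  rw [Matrix.conjTranspose_add, Matrix.conjTranspose_one, Matrix.conjTranspose_single, ht,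
    add_mul, one_mul, single_mul_hermGram, ← hb, mul_add, mul_one, add_mul, hermGram_mul_single,
    ← hb, Matrix.single_mul_single_of_ne _ _ _ _ hab.symm, add_zero, add_assoc,
    ← Matrix.single_add]
  simp

/-- A change of basis to an orthonormal one identifies `SU_n` with the special unitary group of the
standard Hermitian form. -/
def suEquiv (hstar : ∀ x : E, star x = FiniteField.frobeniusAlgHom F E x)
    {T : Matrix (Fin n) (Fin n) E} (hT : Tᴴ * hermGram n E * T = 1) :
    SU n F E ≃* Matrix.specialUnitaryGroup (Fin n) E where
  toFun u := ⟨Tᴴ * hermGram n E * u.1.1 * T, by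
    have hT' : T * (Tᴴ * hermGram n E) = 1 := mul_eq_one_comm.1 hT
    rw [Matrix.mem_specialUnitaryGroup_iff, Matrix.mem_unitaryGroup_iff',
      Matrix.star_eq_conjTranspose]
    constructor
    · calc _ = Tᴴ * (u.1.1ᴴ * (hermGram n E)ᴴ * (T * (Tᴴ * hermGram n E)) * u.1.1) * T := by
            simp only [Matrix.conjTranspose_mul, Matrix.conjTranspose_conjTranspose,
              Matrix.mul_assoc]
        _ = 1 := by
            rw [hT', Matrix.mul_one, conjTranspose_hermGram, (mem_SU_iff hstar _).1 u.2, hT]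
    · rw [Matrix.det_mul, Matrix.det_mul, u.1.2, mul_one, ← Matrix.det_mul, hT, Matrix.det_one]⟩
  invFun M := ⟨⟨T * M.1 * (Tᴴ * hermGram n E), by
      rw [Matrix.det_mul, Matrix.det_mul, (Matrix.mem_specialUnitaryGroup_iff.1 M.2).2, mul_one,
        ← Matrix.det_mul, mul_eq_one_comm.1 hT, Matrix.det_one]⟩, by
    have hT' : T * (Tᴴ * hermGram n E) = 1 := mul_eq_one_comm.1 hT
    refine (mem_SU_iff hstar _).2 ?_
    calc _ = (hermGram n E)ᴴ * T * (M.1ᴴ * (Tᴴ * hermGram n E * T) * M.1) *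
          (Tᴴ * hermGram n E) := by
            simp only [Matrix.conjTranspose_mul, Matrix.conjTranspose_conjTranspose,
              Matrix.mul_assoc]
      _ = hermGram n E := by
            rw [hT, Matrix.mul_one, specialUnitary_isometry, Matrix.mul_one, Matrix.mul_assoc, hT',
              Matrix.mul_one, conjTranspose_hermGram]⟩
  left_inv u := by
    have hT' : T * (Tᴴ * hermGram n E) = 1 := mul_eq_one_comm.1 hT
    apply Subtype.ext
    apply Subtype.ext
    calc _ = T * (Tᴴ * hermGram n E) * u.1.1 * (T * (Tᴴ * hermGram n E)) := by
            simp only [Matrix.mul_assoc]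
      _ = u.1.1 := by rw [hT', Matrix.one_mul, Matrix.mul_one]
  right_inv M := by
    apply Subtype.ext
    calc _ = Tᴴ * hermGram n E * T * M.1 * (Tᴴ * hermGram n E * T) := by
            simp only [Matrix.mul_assoc]
      _ = M.1 := by rw [hT, Matrix.one_mul, Matrix.mul_one]
  map_mul' u v := by
    have hT' : T * (Tᴴ * hermGram n E) = 1 := mul_eq_one_comm.1 hT
    apply Subtype.ext
    change Tᴴ * hermGram n E * (u.1.1 * v.1.1) * T =
      Tᴴ * hermGram n E * u.1.1 * T * (Tᴴ * hermGram n E * v.1.1 * T)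
    calc _ = Tᴴ * hermGram n E * u.1.1 * (1 * v.1.1 * T) := by
            simp only [Matrix.mul_assoc, Matrix.one_mul]
      _ = _ := by
            rw [← hT']
            simp only [Matrix.mul_assoc]

theorem suEquiv_one_add (hstar : ∀ x : E, star x = FiniteField.frobeniusAlgHom F E x)
    {T : Matrix (Fin n) (Fin n) E} (hT : Tᴴ * hermGram n E * T = 1) {u : SU n F E}
    {X : Matrix (Fin n) (Fin n) E} (hu : u.1.1 = 1 + X) :
    (suEquiv hstar hT u).1 = 1 + Tᴴ * hermGram n E * X * T := by
  change Tᴴ * hermGram n E * u.1.1 * T = _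
  rw [hu, mul_add, mul_one, add_mul, hT]

/-- A root element is 1 + X with X supported on the root plane. Both T and its inverse commute with
the projection D onto that plane, so the conjugate of X has the same support. -/
theorem suEquiv_root_closure (hstar : ∀ x : E, star x = FiniteField.frobeniusAlgHom F E x)
    {x y : Fin n → E} (hT : (crossMatrix x y)ᴴ * hermGram n E * crossMatrix x y = 1) {a : Fin n}
    (ha : a ≠ a.rev) :
    ∀ u ∈ Subgroup.closure (suLongRootSet F E ha ∪ suLongRootSet F E ha.symm),
      ∃ c, (suEquiv hstar hT u).1 = inflate (coordPlane E a a.rev) c := by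
  refine exists_inflate_of_closure _ (coordPlane_isometry ha) fun u hu => ?_
  have hcomm := crossMatrix_comm x y a
  set T := crossMatrix x y
  set D : Matrix (Fin n) (Fin n) E := Matrix.single a a 1 + Matrix.single a.rev a.rev 1 with hD
  have hT' : T * (Tᴴ * hermGram n E) = 1 := mul_eq_one_comm.1 hT
  have hcomm' : D * (Tᴴ * hermGram n E) = Tᴴ * hermGram n E * D := by
    calc _ = Tᴴ * hermGram n E * T * D * (Tᴴ * hermGram n E) := by rw [hT, Matrix.one_mul]
      _ = Tᴴ * hermGram n E * (D * T) * (Tᴴ * hermGram n E) := by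
        rw [hcomm]
        simp only [Matrix.mul_assoc]
      _ = Tᴴ * hermGram n E * D * (T * (Tᴴ * hermGram n E)) := by simp only [Matrix.mul_assoc]
      _ = _ := by rw [hT', Matrix.mul_one]
  obtain ⟨X, hX, hDX, hXD⟩ : ∃ X, u.1.1 = 1 + X ∧ D * X = X ∧ X * D = X := by
    rcases hu with ⟨t, ht⟩ | ⟨t, ht⟩
    · exact ⟨Matrix.single a a.rev t, congrArg Subtype.val ht, diag_pair_mul_single ha t,
        single_mul_diag_pair ha t⟩
    · refine ⟨Matrix.single a.rev a t, congrArg Subtype.val ht, ?_, ?_⟩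
      · rw [hD, add_comm, diag_pair_mul_single ha.symm]
      · rw [hD, add_comm, single_mul_diag_pair ha.symm]
  rw [suEquiv_one_add hstar hT hX]
  refine ⟨_, one_add_eq_inflate ?_ ?_⟩
  · rw [coordPlane_mul_conjTranspose, ← hD, ← Matrix.mul_assoc, ← Matrix.mul_assoc, hcomm',
      Matrix.mul_assoc _ D X, hDX]
  · rw [coordPlane_mul_conjTranspose, ← hD, Matrix.mul_assoc, ← hcomm, ← Matrix.mul_assoc,
      Matrix.mul_assoc _ X D, hXD]

theorem exists_suEquiv_eq_planeInvolution
    (hstar : ∀ x : E, star x = FiniteField.frobeniusAlgHom F E x) {x y : Fin n → E}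
    (hT : (crossMatrix x y)ᴴ * hermGram n E * crossMatrix x y = 1) {a : Fin n} (ha : a ≠ a.rev)
    {z : E} (hz : star z ≠ z) :
    ∃ h ∈ Subgroup.closure (suLongRootSet F E ha ∪ suLongRootSet F E ha.symm),
      suEquiv hstar hT h = planeInvolution ⟨coordPlane E a a.rev, coordPlane_isometry ha⟩ := by
  -- The difference of an element and its conjugate is a nonzero element of trace zero, as root
  -- elements require; -1/t then has trace zero too.
  obtain ⟨t, ht0, ht⟩ : ∃ t : E, t ≠ 0 ∧ star t = -t :=
    ⟨z - star z, sub_ne_zero.2 hz.symm, by rw [star_sub, star_star, neg_sub]⟩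
  have hti : star (-t⁻¹) = -(-t⁻¹) := by rw [star_neg, star_inv₀, ht, inv_neg]
  have hx := Subgroup.subset_closure (k := suLongRootSet F E ha ∪ suLongRootSet F E ha.symm)
    (Or.inl ⟨t, rfl⟩ : ⟨_, transvection_mem_SU hstar ha rfl ht⟩ ∈ _)
  have hy := Subgroup.subset_closure (k := suLongRootSet F E ha ∪ suLongRootSet F E ha.symm)
    (Or.inr ⟨-t⁻¹, rfl⟩ : ⟨_, transvection_mem_SU hstar ha.symm (Fin.rev_rev a).symm hti⟩ ∈ _)
  refine ⟨_, pow_mem (mul_mem (mul_mem hx hy) hx) 2, ?_⟩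
  apply Subtype.ext
  change _ = inflate (coordPlane E a a.rev) (-1)
  -- The squared Weyl element is 1 - 2D, with D the projection onto the root plane, and the basis
  -- change leaves D in place.
  rw [suEquiv_one_add hstar hT (X := -((2 : E) •
    (Matrix.single a a 1 + Matrix.single a.rev a.rev 1)))
    ((transvection_weyl_sq ha ht0).trans (sub_eq_add_neg _ _)), inflate_coordPlane_neg_one,
    Matrix.mul_assoc, neg_mul, smul_mul_assoc, crossMatrix_comm, mul_neg, mul_smul_comm,
    ← Matrix.mul_assoc, hT, Matrix.one_mul, sub_eq_add_neg]

end Unitary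

theorem exists_star_ne {F E : Type*} [Field F] [Fintype F] [Field E] [Algebra F E] [StarRing E]
    (hE : Module.finrank F E = 2) (hA : QuadraticStar F E) : ∃ z : E, star z ≠ z := by
  by_contra! h
  have h1 : (⊥ : Subalgebra F E) = ⊤ :=
    (Algebra.surjective_algebraMap_iff.1 fun z => hA.exists_of_star_eq z (h z)).symm
  have := Subalgebra.bot_eq_top_iff_finrank_eq_one.1 h1
  omega

theorem PSU.uniformProb_classical_ge {n : ℕ} {F E : Type*} [Field F] [Fintype F] [Field E]
    [Algebra F E] (hE : Module.finrank F E = 2) (hn : 3 ≤ n)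
    (hodd : Odd (Fintype.card F)) (hq : 3 < Fintype.card F) {K : Subgroup (PSU n F E)}
    (hK : PSU.IsLongRootSL2 K) {i : PSU n F E} (hi : i ∈ K) (hi2 : orderOf i = 2) :
    1 / 750 * (1 - 2 / (Fintype.card F : ℝ)) ≤
      uniformProb fun g : PSU n F E => PSU.IsClassicalInvolution (zeta0 i g) := by
  let := frobeniusStarRing F E hE
  have hA : QuadraticStar F E := quadraticStar_frobenius hE hodd
  have : Module.Finite F E := Module.finite_of_finrank_pos (by omega)
  have : Finite E := Module.finite_of_finite F
  have hr : 3 ≤ Fintype.card (Fin n) := by simpa using hn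
  obtain ⟨z, hz⟩ := exists_star_ne hE hA
  obtain ⟨δ, hδ⟩ := hA.exists_norm_eq (-1) (neg_ne_zero.2 one_ne_zero)
  obtain ⟨x, y, hT⟩ := exists_crossMatrix_form (n := n)
    (QuadraticStar.isUnit_two (F := F) (A := E) hodd).ne_zero ⟨δ, by simpa using hδ⟩
  let e : SU n F E ≃* Matrix.specialUnitaryGroup (Fin n) E := suEquiv (fun _ => rfl) hT
  obtain ⟨a, ha, g, rfl⟩ := hK
  obtain ⟨P, rfl⟩ := hA.exists_planeInvolution e hodd hr
    (P := ⟨_, coordPlane_isometry ha⟩) (suEquiv_root_closure _ hT ha) hi hi2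
  refine hA.uniformProb_ge e hodd hq hr (fun Z => ?_) P
  obtain ⟨g, hg⟩ := hA.exists_mem_conj e hr (exists_suEquiv_eq_planeInvolution _ hT ha hz) Z
  exact ⟨hA.orderOf_mk_planeInvolution e hodd hr Z, _, ⟨a, ha, g, rfl⟩, hg⟩

theorem mainTheorem5 (n q : ℕ) (hn : 3 ≤ n) (hodd : Odd q) (hq : 3 < q)
    (F : Type*) [Field F] [Fintype F] (hF : Fintype.card F = q) :
    (∀ K : Subgroup (PSL n F), PSL.IsLongRootSL2 K → ∀ i ∈ K, orderOf i = 2 →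
      1 / 750 * (1 - 2 / (q : ℝ)) ≤
        uniformProb fun g : PSL n F => PSL.IsClassicalInvolution (zeta0 i g)) ∧
    (∀ (E : Type*) [Field E] [Algebra F E], Module.finrank F E = 2 →
      ∀ K : Subgroup (PSU n F E), PSU.IsLongRootSL2 K → ∀ i ∈ K, orderOf i = 2 →
        1 / 750 * (1 - 2 / (q : ℝ)) ≤
          uniformProb fun g : PSU n F E => PSU.IsClassicalInvolution (zeta0 i g)) := by
  subst hF
  exact ⟨fun K hK i hi hi2 => PSL.uniformProb_classical_ge hn hodd hq hK hi hi2,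
    fun E _ _ hE K hK i hi hi2 => PSU.uniformProb_classical_ge hE hn hodd hq hK hi hi2⟩
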